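/- \textbf{Setting.} Let $N$ agents be the vertices of a connected undirected graph $\mathcal G$, and let $P=(p_{ij})\in\mathbb R^{N\times N}$ be an average consensus matrix on it: $P$ is entrywise nonnegative, symmetric, $P\mathbf 1=\mathbf 1$, for $i\ne j$ one has $p_{ij}>0$ if and only if $\{i,j\}$ is an edge of $\mathcal G$, and either $p_{ii}>0$ for some $i$ or $\mathcal G$ is not bipartite. Let $f_1,\dots,f_N:\mathbb R^n\to\mathbb R$, $\overline f=\frac1N\sum_i f_i$, and let $x^*$ be a minimizer of $\overline f$ over $\mathbb R^n$. Fix $c>0$ and one of the three choices $h_i=\nabla^2 f_i$ (for all $i$), $h_i=\mathrm{diag}[\nabla^2 f_i]$ (for all $i$), or $h_i=I$ (for all $i$); in the last case let moreover $c\le 1$. Put $g_i(x)=h_i(x)x-\nabla f_i(x)$, $\overline{\overline g}(x)=\frac1N\sum_i g_i(x)$, $\overline{\overline h}(x)=\frac1N\sum_i h_i(x)$. For $Z\in\mathbb R^{n\times n}$ and $a\in\mathbb R$ write $Z\ge aI$ if $u^TZu\ge a\,u^Tu$ for all $u\in\mathbb R^n$, and let $[Z]_c=Z$ if $Z\ge\frac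 c2 I$ and $[Z]_c=\frac c2 I$ otherwise. Vectors carry the Euclidean norm, matrices the Frobenius norm. For $\varepsilon>0$, the Newton--Raphson consensus algorithm has variables $x_i(k),y_i(k)\in\mathbb R^n$, $z_i(k)\in\mathbb R^{n\times n}$ and registers $v_i(k)\in\mathbb R^n$, $w_i(k)\in\mathbb R^{n\times n}$ and, from arbitrary initial values at $k=0$, performs for $k=1,2,\dots$ and $i=1,\dots,N$ $$x_i(k)=(1-\varepsilon)x_i(k-1)+\varepsilon\,[z_i(k-1)]_c^{-1}y_i(k-1),$$ $$y_i(k)=\sum_{j}p_{ij}\big(y_j(k-1)+g_j(x_j(k-1))-v_j(k-1)\big),\qquad v_i(k)=g_i(x_i(k-1)),$$ $$z_i(k)=\sum_{j}p_{ij}\big(z_j(k-1)+h_j(x_j(k-1))-w_j(k-1)\big),\qquad w_i(k)=h_i(x_i(k-1)).$$ (The initial register values $v_i(0)$ and $w_i(0)$ play the role of "$g_i(x_i(-1))$" and "$h_i(x_i(-1))$".) Put $\xi^y=\frac1N\sum_i\big(y_i(0)-v_i(0)\big)$ and $\xi^z=\frac1N\sum_i\big(z_i(0)-w_i(0)\big)$.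 \textbf{Theorem.} Assume that every $f_i$ is of class $C^3$ and that $\nabla^2\overline f(x^*)\ge cI$. Then there exist positive scalars $a,r,\overline\varepsilon$ and a continuously differentiable map $\Psi:\mathbb R^n\times\mathbb R^{n\times n}\to\mathbb R^n$ such that $$\|\Psi(\eta,\zeta)-x^*\|\le a\big(\|\eta\|+\|\zeta\|\big)\qquad\text{for all }(\eta,\zeta)\in\mathbb R^n\times\mathbb R^{n\times n},$$ and such that, for every $\varepsilon\in(0,\overline\varepsilon)$ and all initial conditions satisfying, for every $i$, $$\|x_i(0)-x^*\|\le r,\quad \|y_i(0)-\overline{\overline g}(x^*)\|\le r,\quad \|z_i(0)-\overline{\overline h}(x^*)\|\le r,\quad \|v_i(0)-\overline{\overline g}(x^*)\|\le r,\quad \|w_i(0)-\overline{\overline h}(x^*)\|\le r,$$ one has $\lim_{k\to\infty}x_i(k)=\Psi(\xi^y,\xi^z)$ for all $i=1,\dots,N$. -/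

import Mathlib

open Filter Topology

attribute [local instance] Matrix.frobeniusNormedAddCommGroup Matrix.frobeniusNormedSpace

namespace NRC

/-- `ℝⁿ` with the Euclidean norm. -/
abbrev Vec (n : ℕ) : Type := EuclideanSpace ℝ (Fin n)

/-- `ℝⁿˣⁿ`, carrying the Frobenius norm. -/
abbrev Mat (n : ℕ) : Type := Matrix (Fin n) (Fin n) ℝ

/-- The matrix-vector product on Euclidean space. -/
noncomputable def act {n : ℕ} (A : Mat n) (x : Vec n) : Vec n :=
  WithLp.toLp 2 (A.mulVec x.ofLp)

/-- The Hessian matrix of `f` at `x`: the Jacobian matrix of the gradient. -/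
noncomputable def hessian {n : ℕ} (f : Vec n → ℝ) (x : Vec n) : Mat n :=
  Matrix.of fun i j => (fderiv ℝ (gradient f) x (EuclideanSpace.single j 1)) i

/-- `Z ≥ a I`, in the sense of quadratic forms: `uᵀ Z u ≥ a uᵀ u` for every `u`. For symmetric `Z`
this is the Loewner order; `Z` is not required to be symmetric. -/
def GeScalar {n : ℕ} (Z : Mat n) (a : ℝ) : Prop :=
  ∀ u : Fin n → ℝ, a * (u ⬝ᵥ u) ≤ u ⬝ᵥ Z.mulVec u

open Classical in
/-- The threshold operator `[Z]_c`: it is `Z` if `Z ≥ (c/2) I`, and `(c/2) I` otherwise. -/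
noncomputable def clip {n : ℕ} (c : ℝ) (Z : Mat n) : Mat n :=
  if GeScalar Z (c / 2) then Z else (c / 2) • (1 : Mat n)

/-- The three admissible structures of the local curvature functions `h_i`. -/
inductive Curvature where
  | newton
  | jacobi
  | gradient

/-- `h(x)` for a cost `f`: the Hessian, its diagonal part, or the identity. -/
noncomputable def hFun {n : ℕ} (s : Curvature) (f : Vec n → ℝ) (x : Vec n) : Mat n :=
  match s with
  | .newton => hessian f x
  | .jacobi => Matrix.diagonal fun i => hessian f x i i
  | .gradient => 1

/-- `g(x) = h(x) x - ∇f(x)`. -/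
noncomputable def gFun {n : ℕ} (s : Curvature) (f : Vec n → ℝ) (x : Vec n) : Vec n :=
  act (hFun s f x) x - gradient f x

/-- Arithmetic mean over the agents. -/
noncomputable def mean {N : ℕ} {E : Type*} [AddCommGroup E] [Module ℝ E] (v : Fin N → E) : E :=
  (N : ℝ)⁻¹ • ∑ i, v i

/-- The global cost, the mean of the local costs. -/
noncomputable def globalCost {N n : ℕ} (f : Fin N → Vec n → ℝ) (x : Vec n) : ℝ :=
  mean fun i => f i x

/-- `P` is an average consensus matrix on the graph `G`: it is stochastic and symmetric, its
positive off-diagonal entries are exactly those on the edges of `G`, the graph is connected, and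
the network (with a self-loop at `i` whenever `P i i > 0`) is not bipartite. -/
structure IsConsensusMatrix {N : ℕ} (G : SimpleGraph (Fin N)) (P : Matrix (Fin N) (Fin N) ℝ) :
    Prop where
  nonneg : ∀ i j, 0 ≤ P i j
  row_sum : ∀ i, ∑ j, P i j = 1
  symm : P.IsSymm
  pos_iff : ∀ i j, i ≠ j → (0 < P i j ↔ G.Adj i j)
  connected : G.Connected
  aperiodic : (∃ i, 0 < P i i) ∨ ¬ G.IsBipartite

/-- The variables of all the agents at time `k`. The registers `v i` and `w i` hold
`g_i(x_i(k-1))` and `h_i(x_i(k-1))`; at time `0` their contents are arbitrary. -/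
structure State (N n : ℕ) where
  x : Fin N → Vec n
  y : Fin N → Vec n
  z : Fin N → Mat n
  v : Fin N → Vec n
  w : Fin N → Mat n

/-- One iteration of the Newton-Raphson consensus algorithm. -/
noncomputable def step {N n : ℕ} (s : Curvature) (f : Fin N → Vec n → ℝ)
    (P : Matrix (Fin N) (Fin N) ℝ) (c ε : ℝ) (S : State N n) : State N n where
  x := fun i => (1 - ε) • S.x i + ε • act (clip c (S.z i))⁻¹ (S.y i)
  y := fun i => ∑ j, P i j • (S.y j + gFun s (f j) (S.x j) - S.v j)
  z := fun i => ∑ j, P i j • (S.z j + hFun s (f j) (S.x j) - S.w j)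
  v := fun i => gFun s (f i) (S.x i)
  w := fun i => hFun s (f i) (S.x i)

/-- The state after `k` iterations from the initial state `S`. -/
noncomputable def run {N n : ℕ} (s : Curvature) (f : Fin N → Vec n → ℝ)
    (P : Matrix (Fin N) (Fin N) ℝ) (c ε : ℝ) (S : State N n) (k : ℕ) : State N n :=
  (step s f P c ε)^[k] S

/-- `ξ^y`, the mean of `y_i(0) - g_i(x_i(-1))`. -/
noncomputable def State.xiY {N n : ℕ} (S : State N n) : Vec n :=
  mean fun i => S.y i - S.v i

/-- `ξ^z`, the mean of `z_i(0) - h_i(x_i(-1))`. -/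
noncomputable def State.xiZ {N n : ℕ} (S : State N n) : Mat n :=
  mean fun i => S.z i - S.w i

/-- The initial conditions are within `r` of the reference values at `p`: the `x_i(0)` of `p`,
the `y_i(0)` and `g_i(x_i(-1))` of the mean of the `g_j(p)`, and
the `z_i(0)` and `h_i(x_i(-1))` of the mean of the `h_j(p)`. -/
structure State.Near {N n : ℕ} (s : Curvature) (f : Fin N → Vec n → ℝ) (p : Vec n) (r : ℝ)
    (S : State N n) : Prop where
  x : ∀ i, ‖S.x i - p‖ ≤ r
  y : ∀ i, ‖S.y i - mean fun j => gFun s (f j) p‖ ≤ r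
  z : ∀ i, ‖S.z i - mean fun j => hFun s (f j) p‖ ≤ r
  v : ∀ i, ‖S.v i - mean fun j => gFun s (f j) p‖ ≤ r
  w : ∀ i, ‖S.w i - mean fun j => hFun s (f j) p‖ ≤ r

end NRC

namespace NRC

/-! Write Y for the pairs (y, z), φ_j for (g_j, h_j) and F(y, z) = [z]_c⁻¹ y. `P` is doubly
stochastic, so mean Y(k) = ξ + mean_j φ_j(x_j(k-1)) for k ≥ 1, with ξ = (ξ^y, ξ^z) fixed by the
initial data (`IsOrbit.mean_sub`). Disagreement decays at a rate independent of ε, while x moves by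
O(ε) per step. Hence all agents follow, up to small errors, the Euler scheme x ↦ (1-ε)x + εT_ξ(x)
with T_ξ(x) = F(ξ + mean_j φ_j(x)), whose equilibria are the fixed points of T_ξ.

Since the mean gradient vanishes at x*, T_0 fixes x*. The derivatives of h cancel there and DT_0(x*)
= I - h⁻¹H, with h the mean curvature and H the Hessian of the global cost at x*
(`reduced_derivative`). In suitable coordinates h⁻¹H is strongly monotone, so the linearized Euler
step contracts by 1 - εμ. In particular I - DT_0(x*) is injective, and the implicit function theorem
yields a C¹ branch of fixed points Ψ(ξ), cut off by a bump function (`exists_equilibrium_map`).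

Convergence to Ψ(ξ) comes from a weighted sum of four errors: distance of one agent from Ψ(ξ),
spread of the estimates, disagreement of Y, length of the last move. For small ε it decays
geometrically (`exists_lyapunov_weights`, `LocalData.local_convergence`). It need not be small at
the start: the φ_j(x*) may differ between agents, so the first round can inject a disagreement of
order one. `LocalData.transient` waits a number of rounds independent of ε for this to decay;
meanwhile x barely moves, because the threshold gives the global bound ‖F(Y)‖ ≤ (2/c)‖Y‖. -/

/-! ### Spectral gap of a consensus matrix. -/

theorem IsConsensusMatrix.pos_symm {N : ℕ} {G : SimpleGraph (Fin N)}
    {P : Matrix (Fin N) (Fin N) ℝ} (hP : IsConsensusMatrix G P) {i j : Fin N} (h : 0 < P i j) :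
    0 < P j i := by
  rwa [← hP.symm.apply i j] at h

theorem IsConsensusMatrix.induction {N : ℕ} {G : SimpleGraph (Fin N)}
    {P : Matrix (Fin N) (Fin N) ℝ} (hP : IsConsensusMatrix G P) (I : Fin N → Prop) (a : Fin N)
    (ha : I a) (hstep : ∀ u w, 0 < P u w → I u → I w) (u : Fin N) : I u := by
  obtain ⟨p⟩ := hP.connected.preconnected a u
  induction p with
  | nil => exact ha
  | cons h _ ih => exact ih (hstep _ _ ((hP.pos_iff _ _ h.ne).2 h) ha)

/-- A function that agrees on any two agents with a common neighbour is constant. -/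
theorem IsConsensusMatrix.eq_of_common {N : ℕ} {G : SimpleGraph (Fin N)}
    {P : Matrix (Fin N) (Fin N) ℝ} (hP : IsConsensusMatrix G P) {v : Fin N → ℝ}
    (h : ∀ i j k, 0 < P i j → 0 < P i k → v j = v k) (i j : Fin N) : v i = v j := by
  by_cases hA : ∃ a b, 0 < P a b ∧ v a = v b
  -- One edge with equal end values forces the value v a everywhere: the property that u and all its
  -- neighbours carry v a passes along edges.
  · obtain ⟨a, b, hab, hv⟩ := hA
    have key : ∀ u, v u = v a ∧ ∀ w, 0 < P u w → v w = v a := by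
      refine hP.induction (fun u => v u = v a ∧ ∀ w, 0 < P u w → v w = v a) a ?_ ?_
      · exact ⟨rfl, fun w hw => (h a w b hw hab).trans hv.symm⟩
      · rintro u w huw ⟨h1, h2⟩
        exact ⟨h2 w huw, fun t ht => (h w t u ht (hP.pos_symm huw)).trans h1⟩
    rw [(key i).1, (key j).1]
  -- If values differ along every edge, there is no self-loop, and membership in the level set of i0
  -- alternates along edges, which is a two-colouring. This contradicts aperiodicity.
  · exfalso
    push Not at hA
    obtain ⟨i0⟩ := hP.connected.nonempty
    have key : ∀ u, v u = v i0 ∨ ∀ w, 0 < P u w → v w = v i0 := by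
      refine hP.induction (fun u => v u = v i0 ∨ ∀ w, 0 < P u w → v w = v i0) i0 ?_ ?_
      · exact Or.inl rfl
      · rintro u w huw (h1 | h2)
        · exact Or.inr fun t ht => (h w t u ht (hP.pos_symm huw)).trans h1
        · exact Or.inl (h2 w huw)
    rcases hP.aperiodic with ⟨a, ha⟩ | hb
    · exact hA a a ha rfl
    · classical
      apply hb
      let C : G.Coloring Bool := SimpleGraph.Coloring.mk (fun u => decide (v u = v i0)) (by
        intro u w huw
        have hp := (hP.pos_iff u w huw.ne).2 huw
        have hne := hA u w hp
        by_cases h1 : v u = v i0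
        · have : v w ≠ v i0 := fun h2 => hne (h1.trans h2.symm)
          simp [h1, this]
        · have h2 := ((key u).resolve_left h1) w hp
          simp [h1, h2])
      have := C.colorable
      simpa [SimpleGraph.IsBipartite] using this

/-- The matrix that replaces a family by its deviation from consensus after one round of mixing. -/
noncomputable def deviation {N : ℕ} (P : Matrix (Fin N) (Fin N) ℝ) : Matrix (Fin N) (Fin N) ℝ :=
  P - Matrix.of fun _ _ => (N : ℝ)⁻¹

theorem row_variance {N : ℕ} (p v : Fin N → ℝ) (hp : ∑ j, p j = 1) :
    (∑ j, p j * v j) ^ 2 + ∑ j, p j * (v j - ∑ k, p k * v k) ^ 2 = ∑ j, p j * v j ^ 2 := by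
  set m := ∑ k, p k * v k with hm
  have : ∑ j, p j * (v j - m) ^ 2 = ∑ j, (p j * v j ^ 2 - 2 * m * (p j * v j) + m ^ 2 * p j) :=
    Finset.sum_congr rfl fun j _ => by ring
  rw [this, Finset.sum_add_distrib, Finset.sum_sub_distrib, ← Finset.mul_sum, ← Finset.mul_sum, hp,
    ← hm]
  ring

/-- Averaging loses exactly the variances within the rows, and removing the mean a loses N a² more.
If nothing is lost, v is constant on the support of each row, hence constant by `eq_of_common`, and
its mean is zero. -/
theorem IsConsensusMatrix.sq_deviation_lt {N : ℕ} {G : SimpleGraph (Fin N)}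
    {P : Matrix (Fin N) (Fin N) ℝ} (hP : IsConsensusMatrix G P) (v : Fin N → ℝ) (hv : v ≠ 0) :
    ∑ i, ((deviation P).mulVec v i) ^ 2 < ∑ i, v i ^ 2 := by
  have : Nonempty (Fin N) := hP.connected.nonempty
  have hN : (0 : ℝ) < N := by
    have := Fin.pos_iff_nonempty.2 this
    exact_mod_cast this
  set a := (N : ℝ)⁻¹ * ∑ j, v j with ha
  have hcol : ∀ j, ∑ i, P i j = 1 := fun j => by
    rw [← hP.row_sum j]; exact Finset.sum_congr rfl fun i _ => (hP.symm.apply i j).symm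
  have hM : ∀ i, (deviation P).mulVec v i = ∑ j, P i j * v j - a := fun i => by
    simp [deviation, Matrix.mulVec, dotProduct, sub_mul, Finset.sum_sub_distrib, ha,
      Finset.mul_sum]
  have hsum : ∑ i, ∑ j, P i j * v j = N * a := by
    rw [Finset.sum_comm, ha]
    simp_rw [← Finset.sum_mul, hcol]
    field_simp
  have hsq : ∑ i, ∑ j, P i j * v j ^ 2 = ∑ j, v j ^ 2 := by
    rw [Finset.sum_comm]
    simp_rw [← Finset.sum_mul, hcol, one_mul]
  set D := ∑ i, ∑ j, P i j * (v j - ∑ k, P i k * v k) ^ 2 with hD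
  have hvar : ∑ i, (∑ j, P i j * v j) ^ 2 + D = ∑ j, v j ^ 2 := by
    rw [← hsq, hD, ← Finset.sum_add_distrib]
    exact Finset.sum_congr rfl fun i _ => row_variance _ _ (hP.row_sum i)
  have hexp : ∑ i, ((deviation P).mulVec v i) ^ 2 = ∑ i, (∑ j, P i j * v j) ^ 2 - N * a ^ 2 := by
    have : ∀ i, ((deviation P).mulVec v i) ^ 2
        = (∑ j, P i j * v j) ^ 2 - 2 * a * (∑ j, P i j * v j) + a ^ 2 := fun i => by
      rw [hM]; ring
    simp_rw [this]
    rw [Finset.sum_add_distrib, Finset.sum_sub_distrib, ← Finset.mul_sum, hsum]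
    simp
    ring
  have hDterm : ∀ i j, 0 ≤ P i j * (v j - ∑ k, P i k * v k) ^ 2 := fun i j =>
    mul_nonneg (hP.nonneg i j) (sq_nonneg _)
  have hD0 : 0 ≤ D := Finset.sum_nonneg fun i _ => Finset.sum_nonneg fun j _ => hDterm i j
  by_contra hcon
  push Not at hcon
  have hNa : 0 ≤ N * a ^ 2 := by positivity
  have hDz : D = 0 := by linarith
  have haz : a = 0 := by
    have : N * a ^ 2 = 0 := by linarith
    simpa [hN.ne'] using this
  have hrow : ∀ i j, 0 < P i j → v j = ∑ k, P i k * v k := by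
    intro i j hij
    have h1 := (Finset.sum_eq_zero_iff_of_nonneg
      (fun i _ => Finset.sum_nonneg fun j _ => hDterm i j)).1 hDz i (Finset.mem_univ _)
    have h2 := (Finset.sum_eq_zero_iff_of_nonneg (fun j _ => hDterm i j)).1 h1 j
      (Finset.mem_univ _)
    rcases mul_eq_zero.1 h2 with h3 | h3
    · exact absurd h3 hij.ne'
    · exact sub_eq_zero.1 (pow_eq_zero_iff two_ne_zero |>.1 h3)
  have hconst := hP.eq_of_common (v := v) fun i j k hj hk => (hrow i j hj).trans (hrow i k hk).symm
  apply hv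
  ext i
  have : ∑ j, v j = N * v i := by
    rw [Finset.sum_congr rfl fun j _ => hconst j i]; simp
  rw [ha, this] at haz
  simpa [hN.ne'] using haz

/-- Strict decrease becomes a uniform factor ‖T‖ < 1 because the maximum over the compact unit
sphere is attained. Entrywise bounds are recorded so that they apply to families in any normed
space. -/
theorem IsConsensusMatrix.deviation_pow_le {N : ℕ} {G : SimpleGraph (Fin N)}
    {P : Matrix (Fin N) (Fin N) ℝ} (hP : IsConsensusMatrix G P) :
    ∃ ρ : ℝ, 0 ≤ ρ ∧ ρ < 1 ∧ ∀ k i j, |((deviation P) ^ k) i j| ≤ ρ ^ k := by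
  let T : EuclideanSpace ℝ (Fin N) →L[ℝ] EuclideanSpace ℝ (Fin N) :=
    Matrix.toEuclideanCLM (𝕜 := ℝ) (deviation P)
  have hT : ∀ v, v ≠ 0 → ‖T v‖ < ‖v‖ := by
    intro v hv
    have h1 := hP.sq_deviation_lt v.ofLp (by simpa using hv)
    rw [EuclideanSpace.norm_eq, EuclideanSpace.norm_eq]
    apply Real.sqrt_lt_sqrt (by positivity)
    simpa [T] using h1
  have hT1 : ‖T‖ < 1 := by
    have : Nonempty (Fin N) := hP.connected.nonempty
    have hne : (Metric.sphere (0 : EuclideanSpace ℝ (Fin N)) 1).Nonempty :=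
      NormedSpace.sphere_nonempty.2 zero_le_one
    obtain ⟨u, hu, hmax⟩ := (isCompact_sphere (0 : EuclideanSpace ℝ (Fin N)) 1).exists_isMaxOn hne
      (T.continuous.norm.continuousOn)
    have hu1 : ‖u‖ = 1 := by simpa using hu
    have hu0 : u ≠ 0 := by rintro rfl; simp at hu1
    refine lt_of_le_of_lt ?_ ((hT u hu0).trans_eq hu1)
    refine T.opNorm_le_of_unit_norm (norm_nonneg _) fun v hv => hmax (by simpa using hv)
  refine ⟨‖T‖, norm_nonneg _, hT1, fun k i j => ?_⟩
  have hk : T ^ k = Matrix.toEuclideanCLM (𝕜 := ℝ) (deviation P ^ k) := by simp [T, map_pow]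
  have h1 : ((deviation P) ^ k) i j = ((T ^ k) (EuclideanSpace.single j 1)) i := by
    rw [hk, Matrix.ofLp_toEuclideanCLM]; simp
  rw [h1]
  calc |((T ^ k) (EuclideanSpace.single j 1)) i| ≤ ‖(T ^ k) (EuclideanSpace.single j 1)‖ := by
        simpa using PiLp.norm_apply_le ((T ^ k) (EuclideanSpace.single j 1)) i
    _ ≤ ‖T ^ k‖ * ‖EuclideanSpace.single j (1 : ℝ)‖ := (T ^ k).le_opNorm _
    _ ≤ ‖T‖ ^ k := by
      have : Nontrivial (EuclideanSpace ℝ (Fin N)) := ⟨EuclideanSpace.single j 1, 0, by simp⟩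
      simpa using norm_pow_le T k

/-! ### Mixing of vector-valued families. -/

/-- The action of a weight matrix on a family of vectors. -/
def mix {N : ℕ} {E : Type*} [AddCommGroup E] [Module ℝ E] (M : Matrix (Fin N) (Fin N) ℝ) :
    (Fin N → E) →ₗ[ℝ] (Fin N → E) where
  toFun y i := ∑ j, M i j • y j
  map_add' y y' := by ext i; simp [Finset.sum_add_distrib]
  map_smul' a y := by ext i; simp [Finset.smul_sum, smul_comm a]

section mix
variable {N : ℕ} {E : Type*} [NormedAddCommGroup E] [NormedSpace ℝ E]

theorem mix_apply (M : Matrix (Fin N) (Fin N) ℝ) (y : Fin N → E) (i : Fin N) :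
    mix M y i = ∑ j, M i j • y j := rfl

theorem mix_mul (M M' : Matrix (Fin N) (Fin N) ℝ) (y : Fin N → E) :
    mix (M * M') y = mix M (mix M' y) := by
  ext i
  simp only [mix_apply, Matrix.mul_apply, Finset.sum_smul, Finset.smul_sum, mul_smul]
  exact Finset.sum_comm

theorem mix_one (y : Fin N → E) : mix (1 : Matrix (Fin N) (Fin N) ℝ) y = y := by
  ext i; simp [mix_apply, Matrix.one_apply]

theorem norm_mix_le (M : Matrix (Fin N) (Fin N) ℝ) {b : ℝ} (hb : 0 ≤ b) (hM : ∀ i j, |M i j| ≤ b)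
    (y : Fin N → E) : ‖mix M y‖ ≤ N * b * ‖y‖ := by
  refine (pi_norm_le_iff_of_nonneg (by positivity)).2 fun i => ?_
  calc ‖mix M y i‖ ≤ ∑ j, ‖M i j • y j‖ := by rw [mix_apply]; exact norm_sum_le _ _
    _ ≤ ∑ _j : Fin N, b * ‖y‖ := Finset.sum_le_sum fun j _ => by
        rw [norm_smul]
        exact mul_le_mul (hM i j) (norm_le_pi_norm y j) (norm_nonneg _) hb
    _ = N * b * ‖y‖ := by simp [mul_assoc]

theorem mean_sub (y y' : Fin N → E) : mean (y - y') = mean y - mean y' := by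
  simp [mean, smul_sub]

theorem mean_add (y y' : Fin N → E) : mean (y + y') = mean y + mean y' := by
  simp [mean, Finset.sum_add_distrib]

theorem norm_mean_le (y : Fin N → E) : ‖mean y‖ ≤ ‖y‖ := by
  rcases Nat.eq_zero_or_pos N with rfl | hN
  · simp [mean]
  have hN' : (0 : ℝ) < N := by exact_mod_cast hN
  rw [mean, norm_smul, norm_inv, Real.norm_natCast, inv_mul_le_iff₀ hN']
  calc ‖∑ i, y i‖ ≤ ∑ i, ‖y i‖ := norm_sum_le _ _
    _ ≤ ∑ _i : Fin N, ‖y‖ := Finset.sum_le_sum fun i _ => norm_le_pi_norm y i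
    _ = N * ‖y‖ := by simp

theorem mean_const [NeZero N] (e : E) : mean (fun _ : Fin N => e) = e := by
  have : (N : ℝ) ≠ 0 := by exact_mod_cast NeZero.ne N
  rw [mean, Finset.sum_const, Finset.card_univ, Fintype.card_fin, ← Nat.cast_smul_eq_nsmul ℝ,
    smul_smul, inv_mul_cancel₀ this, one_smul]

theorem mix_deviation (P : Matrix (Fin N) (Fin N) ℝ) (y : Fin N → E) :
    mix (deviation P) y = mix P y - fun _ => mean y := by
  ext i
  simp [mix_apply, deviation, mean, sub_smul, Finset.sum_sub_distrib, Finset.smul_sum]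

theorem IsConsensusMatrix.mean_mix {G : SimpleGraph (Fin N)} {P : Matrix (Fin N) (Fin N) ℝ}
    (hP : IsConsensusMatrix G P) (y : Fin N → E) : mean (mix P y) = mean y := by
  have hcol : ∀ j, ∑ i, P i j = 1 := fun j => by
    rw [← hP.row_sum j]; exact Finset.sum_congr rfl fun i _ => (hP.symm.apply i j).symm
  simp only [mean, mix_apply]
  rw [Finset.sum_comm]
  simp_rw [← Finset.sum_smul, hcol, one_smul]

theorem IsConsensusMatrix.neZero {G : SimpleGraph (Fin N)} {P : Matrix (Fin N) (Fin N) ℝ}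
    (hP : IsConsensusMatrix G P) : NeZero N :=
  ⟨(Fin.pos_iff_nonempty.2 hP.connected.nonempty).ne'⟩

theorem IsConsensusMatrix.mix_deviation_const {G : SimpleGraph (Fin N)}
    {P : Matrix (Fin N) (Fin N) ℝ} (hP : IsConsensusMatrix G P) (e : E) :
    mix (deviation P) (fun _ => e) = 0 := by
  have := hP.neZero
  rw [mix_deviation, mean_const]
  ext i
  simp [mix_apply, ← Finset.sum_smul, hP.row_sum i]

/-- The deviation from the mean after mixing depends only on the deviation before. -/
theorem IsConsensusMatrix.mix_sub_mean {G : SimpleGraph (Fin N)}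
    {P : Matrix (Fin N) (Fin N) ℝ} (hP : IsConsensusMatrix G P) (y d : Fin N → E) :
    (mix P (y + d) - fun _ => mean (mix P (y + d)))
      = mix (deviation P) ((y - fun _ => mean y) + d) := by
  rw [hP.mean_mix, ← mix_deviation, map_add, map_add, map_sub, hP.mix_deviation_const, sub_zero]

/-- A norm, equivalent to the maximum norm, in which deviations from consensus contract. -/
theorem IsConsensusMatrix.exists_contracting_seminorm {G : SimpleGraph (Fin N)}
    {P : Matrix (Fin N) (Fin N) ℝ} (hP : IsConsensusMatrix G P) :
    ∃ (ν : Seminorm ℝ (Fin N → E)) (ρ C : ℝ), 0 < ρ ∧ ρ < 1 ∧ 1 ≤ C ∧ (∀ y, ‖y‖ ≤ ν y) ∧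
      (∀ y, ν y ≤ C * ‖y‖) ∧ ∀ y, ν (mix (deviation P) y) ≤ ρ * ν y := by
  obtain ⟨ρ₀, h0, h1, hpow⟩ := hP.deviation_pow_le
  set M := deviation P
  obtain ⟨ρ, hρ0, hρ1⟩ := exists_between h1
  have hρ : 0 < ρ := h0.trans_lt hρ0
  have hlim : Tendsto (fun k : ℕ => (N : ℝ) * (ρ₀ / ρ) ^ k) atTop (𝓝 (N * 0)) :=
    (tendsto_pow_atTop_nhds_zero_of_lt_one (by positivity) ((div_lt_one hρ).2 hρ0)).const_mul _
  rw [mul_zero] at hlim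
  -- K is so large that ρ^(-K) ‖M^K y‖ ≤ ‖y‖; the slack ρ₀ < ρ absorbs the factor N lost in passing
  -- from entries to the maximum norm.
  obtain ⟨K, hK1, hK⟩ := ((hlim.eventually (gt_mem_nhds one_pos)).and
    (eventually_ge_atTop 1)).exists
  have hpow' : ∀ k (y : Fin N → E), ‖mix (M ^ k) y‖ ≤ N * ρ₀ ^ k * ‖y‖ := fun k y =>
    norm_mix_le _ (by positivity) (hpow k) y
  have hKy : ∀ y : Fin N → E, (ρ⁻¹) ^ K * ‖mix (M ^ K) y‖ ≤ ‖y‖ := fun y => by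
    calc (ρ⁻¹) ^ K * ‖mix (M ^ K) y‖ ≤ (ρ⁻¹) ^ K * (N * ρ₀ ^ K * ‖y‖) := by
          gcongr; exact hpow' K y
      _ = (N * (ρ₀ / ρ) ^ K) * ‖y‖ := by rw [div_pow, inv_pow]; field_simp
      _ ≤ 1 * ‖y‖ := by gcongr
      _ = ‖y‖ := one_mul _
  let ν : Seminorm ℝ (Fin N → E) := Seminorm.of
    (fun y => ∑ k ∈ Finset.range K, (ρ⁻¹) ^ k * ‖mix (M ^ k) y‖)
    (fun y y' => by
      rw [← Finset.sum_add_distrib]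
      refine Finset.sum_le_sum fun k _ => ?_
      rw [map_add, ← mul_add]
      gcongr
      exact norm_add_le _ _)
    (fun a y => by
      rw [Finset.mul_sum]
      refine Finset.sum_congr rfl fun k _ => ?_
      rw [map_smul, norm_smul]; ring)
  have hν : ∀ y, ν y = ∑ k ∈ Finset.range K, (ρ⁻¹) ^ k * ‖mix (M ^ k) y‖ := fun _ => rfl
  refine ⟨ν, ρ, 1 + ∑ k ∈ Finset.range K, (ρ⁻¹) ^ k * (N * ρ₀ ^ k), hρ, hρ1, ?_, ?_, ?_, ?_⟩
  · have : 0 ≤ ∑ k ∈ Finset.range K, (ρ⁻¹) ^ k * (N * ρ₀ ^ k) :=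
      Finset.sum_nonneg fun k _ => by positivity
    linarith
  · intro y
    rw [hν]
    calc ‖y‖ = (ρ⁻¹) ^ 0 * ‖mix (M ^ 0) y‖ := by simp [mix_one]
      _ ≤ _ := Finset.single_le_sum (f := fun k => (ρ⁻¹) ^ k * ‖mix (M ^ k) y‖)
        (fun k _ => by positivity) (Finset.mem_range.2 hK)
  · intro y
    rw [hν, add_mul, Finset.sum_mul]
    refine le_add_of_nonneg_of_le (by positivity) (Finset.sum_le_sum fun k _ => ?_)
    rw [mul_assoc]
    gcongr
    exact hpow' k y
  · intro y
    have e1 : ν (mix M y) = ρ * ∑ k ∈ Finset.range K, (ρ⁻¹) ^ (k + 1) * ‖mix (M ^ (k + 1)) y‖ := by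
      rw [hν, Finset.mul_sum]
      refine Finset.sum_congr rfl fun k _ => ?_
      rw [pow_succ M, mix_mul, pow_succ]
      field_simp
    -- Applying M shifts the weighted sum: it gains the term of index K and loses the term ‖y‖ of
    -- index 0, and the gain does not exceed the loss.
    have e2 : ∑ k ∈ Finset.range K, (ρ⁻¹) ^ (k + 1) * ‖mix (M ^ (k + 1)) y‖
        = ν y + (ρ⁻¹) ^ K * ‖mix (M ^ K) y‖ - ‖y‖ := by
      have h2 := Finset.sum_range_succ (fun k => (ρ⁻¹) ^ k * ‖mix (M ^ k) y‖) K
      have h3 := Finset.sum_range_succ' (fun k => (ρ⁻¹) ^ k * ‖mix (M ^ k) y‖) K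
      simp only [pow_zero, mix_one, one_mul] at h3
      rw [hν]
      linarith
    rw [e1, e2]
    gcongr
    linarith [hKy y]

end mix

/-! ### Lyapunov function and local stability of the abstract recursion. -/

/-- A weighted sum of the consensus errors and the optimization error decays geometrically. -/
theorem exists_lyapunov_weights {μ ρ Λ : ℝ} (hμ : 0 < μ) (hμ1 : μ ≤ 1) (hρ1 : ρ < 1)
    (hΛ : 0 < Λ) :
    ∃ α β γ ν ε₀ : ℝ, 0 < α ∧ 0 < β ∧ 0 < γ ∧ 0 < ν ∧ 0 < ε₀ ∧ ∀ ε, 0 < ε → ε < ε₀ →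
      ∀ m s e D m' s' e' D' : ℝ, 0 ≤ m → 0 ≤ s → 0 ≤ e → 0 ≤ D →
        m' ≤ (1 - ε * μ) * m + ε * Λ * (s + e + D) → s' ≤ (1 - ε) * s + ε * Λ * e →
        e' ≤ ρ * e + Λ * D → D' ≤ ε * Λ * (m + s + e + D) →
        m' + α * s' + β * e' + γ * D' ≤ (1 - ε * ν) * (m + α * s + β * e + γ * D) := by
  -- γΛ = μ/2 lets the feedback of m through D cost half of the rate μ; α dominates what s feeds
  -- into m and D; βΛ = γ/4 charges the forcing of e by D to a quarter of γ. The margins for m and s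
  -- are of order ε, like the perturbations, while those for e and D are of order one, and only
  -- these restrict ε.
  obtain ⟨γ, hγ⟩ : ∃ γ, γ = μ / (2 * Λ) := ⟨_, rfl⟩
  obtain ⟨ν, hν⟩ : ∃ ν, ν = μ / 4 := ⟨_, rfl⟩
  obtain ⟨α, hα⟩ : ∃ α, α = 2 * Λ + μ := ⟨_, rfl⟩
  obtain ⟨β, hβ⟩ : ∃ β, β = γ / (4 * Λ) := ⟨_, rfl⟩
  have hγ0 : 0 < γ := by rw [hγ]; positivity
  have hν0 : 0 < ν := by rw [hν]; positivity
  have hα0 : 0 < α := by rw [hα]; positivity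
  have hβ0 : 0 < β := by rw [hβ]; positivity
  have hγΛ : γ * Λ = μ / 2 := by rw [hγ]; field_simp
  have hβΛ : β * Λ = γ / 4 := by rw [hβ]; field_simp
  have h1ρ : 0 < 1 - ρ := sub_pos.2 hρ1
  refine ⟨α, β, γ, ν, min (β * (1 - ρ) / (Λ + α * Λ + γ * Λ + β * ν))
    ((3 * γ / 4) / (Λ + γ * Λ + γ * ν)), hα0, hβ0, hγ0, hν0, by positivity, ?_⟩
  intro ε hε hεlt m s e D m' s' e' D' hm hs he hD h1 h2 h3 h4
  have hε1 := (lt_div_iff₀ (by positivity)).1 (hεlt.trans_le (min_le_left _ _))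
  have hε2 := (lt_div_iff₀ (by positivity)).1 (hεlt.trans_le (min_le_right _ _))
  have cm : 0 ≤ (ε * (μ - γ * Λ - ν)) * m := by
    have : 0 ≤ μ - γ * Λ - ν := by rw [hγΛ, hν]; linarith
    positivity
  have cs : 0 ≤ (ε * (α * (1 - ν) - Λ - γ * Λ)) * s := by
    have : 0 ≤ α * (1 - ν) - Λ - γ * Λ := by rw [hγΛ, hν, hα]; nlinarith
    positivity
  have ce : 0 ≤ (β * (1 - ρ) - ε * (Λ + α * Λ + γ * Λ + β * ν)) * e :=
    mul_nonneg (by linarith) he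
  have cD : 0 ≤ (3 * γ / 4 - ε * (Λ + γ * Λ + γ * ν)) * D := mul_nonneg (by linarith) hD
  have h2' := mul_le_mul_of_nonneg_left h2 hα0.le
  have h3' := mul_le_mul_of_nonneg_left h3 hβ0.le
  have h4' := mul_le_mul_of_nonneg_left h4 hγ0.le
  have h3'' : β * (ρ * e + Λ * D) = β * ρ * e + γ / 4 * D := by rw [← hβΛ]; ring
  rw [h3''] at h3'
  linarith

section orbit
variable {N : ℕ} {X E : Type*} [NormedAddCommGroup X] [NormedSpace ℝ X]
  [NormedAddCommGroup E] [NormedSpace ℝ E]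

/-- The Newton-Raphson consensus recursion, with the pairs `(y i, z i)` and `(v i, w i)` merged
into `Y i` and `V i`, the pair `(g i, h i)` into `φ i`, and with a general search map `F`. -/
structure IsOrbit (P : Matrix (Fin N) (Fin N) ℝ) (φ : Fin N → X → E) (F : E → X) (ε : ℝ)
    (x : ℕ → Fin N → X) (Y V : ℕ → Fin N → E) : Prop where
  x_succ : ∀ k i, x (k + 1) i = (1 - ε) • x k i + ε • F (Y k i)
  Y_succ : ∀ k, Y (k + 1) = mix P (Y k + ((fun i => φ i (x k i)) - V k))
  V_succ : ∀ k i, V (k + 1) i = φ i (x k i)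

/-- Mixing preserves the mean and each round adds the new φ while removing the stored one, so the
increments telescope. -/
theorem IsOrbit.mean_sub {G : SimpleGraph (Fin N)} {P : Matrix (Fin N) (Fin N) ℝ}
    (hP : IsConsensusMatrix G P) {φ : Fin N → X → E} {F : E → X} {ε : ℝ} {x : ℕ → Fin N → X}
    {Y V : ℕ → Fin N → E} (h : IsOrbit P φ F ε x Y V) (k : ℕ) :
    mean (Y k) = mean (Y 0 - V 0) + mean (V k) := by
  induction k with
  | zero => rw [NRC.mean_sub]; abel
  | succ k ih =>
    have : V (k + 1) = fun i => φ i (x k i) := funext (h.V_succ k)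
    rw [h.Y_succ, hP.mean_mix, mean_add, NRC.mean_sub, ih, this]
    abel

/-- Lipschitz and linearization estimates near the reference point. -/
structure LocalData (φ : Fin N → X → E) (F : E → X) (B : X →L[ℝ] X) (xs : X) (p : E)
    (L R δ : ℝ) : Prop where
  L_pos : 0 < L
  R_pos : 0 < R
  φ_lip : ∀ j x x', ‖x - xs‖ ≤ R → ‖x' - xs‖ ≤ R → ‖φ j x - φ j x'‖ ≤ L * ‖x - x'‖
  F_lip : ∀ y y', ‖y - p‖ ≤ R → ‖y' - p‖ ≤ R → ‖F y - F y'‖ ≤ L * ‖y - y'‖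
  lin : ∀ ξ x x', ‖ξ‖ ≤ R → ‖x - xs‖ ≤ R → ‖x' - xs‖ ≤ R →
    ‖F (ξ + mean fun j => φ j x) - F (ξ + mean fun j => φ j x') - B (x - x')‖ ≤ δ * ‖x - x'‖

theorem LocalData.mean_lip {φ : Fin N → X → E} {F : E → X} {B : X →L[ℝ] X} {xs : X} {p : E}
    {L R δ : ℝ} (h : LocalData φ F B xs p L R δ) {x x' : Fin N → X} (hx : ∀ j, ‖x j - xs‖ ≤ R)
    (hx' : ∀ j, ‖x' j - xs‖ ≤ R) {b : ℝ} (hb : 0 ≤ b) (hxx : ∀ j, ‖x j - x' j‖ ≤ b) :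
    ‖(mean fun j => φ j (x j)) - mean fun j => φ j (x' j)‖ ≤ L * b := by
  rw [← mean_sub]
  refine (norm_mean_le _).trans ((pi_norm_le_iff_of_nonneg
    (mul_nonneg h.L_pos.le hb)).2 fun j => ?_)
  exact (h.φ_lip j _ _ (hx j) (hx' j)).trans (mul_le_mul_of_nonneg_left (hxx j) h.L_pos.le)

/-- The errors are m (agent i₀ against the equilibrium, measured through S), s (spread of x), e
(disagreement of Y) and D (last move of x). D enters because Y carries φ at the previous estimates
xp. Λ collects the constants of all four bounds. -/
theorem step_estimates {G : SimpleGraph (Fin N)} {P : Matrix (Fin N) (Fin N) ℝ}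
    (hP : IsConsensusMatrix G P)
    {φ : Fin N → X → E} {F : E → X} {B : X →L[ℝ] X} {xs : X} {p : E}
    {L R δ : ℝ} (h : LocalData φ F B xs p L R δ)
    {ν : Seminorm ℝ (Fin N → E)} {ρ C : ℝ} (hρ : 0 < ρ) (hρ1 : ρ ≤ 1) (hC : 0 ≤ C)
    (hν : ∀ y, ‖y‖ ≤ ν y) (hνC : ∀ y, ν y ≤ C * ‖y‖)
    (hνρ : ∀ y, ν (mix (deviation P) y) ≤ ρ * ν y)
    {S : X →L[ℝ] X} {CS : ℝ} (hCS : 0 ≤ CS) (hS : ∀ d, ‖d‖ ≤ CS * ‖S d‖) {ε μ : ℝ} (hε : 0 < ε)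
    (hε1 : ε ≤ 1)
    (hB : ∀ d, ‖S ((1 - ε) • d + ε • B d)‖ ≤ (1 - ε * μ) * ‖S d‖)
    (hδ : ‖S‖ * δ * CS ≤ μ / 2)
    {Λ : ℝ} (hΛ : Λ = ‖S‖ * L + ‖S‖ * L ^ 2 + 2 * L + C * L + L ^ 2 + (L ^ 2 + 1) * CS + 1)
    (i₀ : Fin N) {ξ : E} {xh : X} (hfix : F (ξ + mean fun j => φ j xh) = xh)
    {x xp : Fin N → X} {Y : Fin N → E} (hmean : mean Y = ξ + mean fun j => φ j (xp j))
    (hξR : ‖ξ‖ ≤ R) (hxh : ‖xh - xs‖ ≤ R)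
    (hξR₂ : ‖(ξ + mean fun j => φ j xh) - p‖ ≤ R) (hx : ∀ i, ‖x i - xs‖ ≤ R)
    (hxp : ∀ i, ‖xp i - xs‖ ≤ R)
    (hY : ∀ i, ‖Y i - p‖ ≤ R) (hYx : ‖(ξ + mean fun j => φ j (x i₀)) - p‖ ≤ R)
    {x' : Fin N → X} {Y' : Fin N → E} (hx' : ∀ i, x' i = (1 - ε) • x i + ε • F (Y i))
    (hY' : Y' = mix P (Y + ((fun i => φ i (x i)) - fun i => φ i (xp i))))
    {m s e D m' s' e' D' : ℝ} (hm : m = ‖S (x i₀ - xh)‖) (hs : s = ‖fun i => x i - x i₀‖)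
    (he : e = ν (Y - fun _ => mean Y)) (hD : D = ‖x - xp‖)
    (hm' : m' = ‖S (x' i₀ - xh)‖) (hs' : s' = ‖fun i => x' i - x' i₀‖)
    (he' : e' = ν (Y' - fun _ => mean Y')) (hD' : D' = ‖x' - x‖) :
    m' ≤ (1 - ε * (μ / 2)) * m + ε * Λ * (s + e + D) ∧ s' ≤ (1 - ε) * s + ε * Λ * e ∧
      e' ≤ ρ * e + Λ * D ∧ D' ≤ ε * Λ * (m + s + e + D) := by
  have hL := h.L_pos
  have hm0 : 0 ≤ m := hm ▸ norm_nonneg _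
  have hs0 : 0 ≤ s := hs ▸ norm_nonneg _
  have he0 : 0 ≤ e := he ▸ apply_nonneg _ _
  have hD0 : 0 ≤ D := hD ▸ norm_nonneg _
  have hsi : ∀ i, ‖x i - x i₀‖ ≤ s := fun i => hs ▸ norm_le_pi_norm (fun i => x i - x i₀) i
  have hDi : ∀ i, ‖x i - xp i‖ ≤ D := fun i => hD ▸ norm_le_pi_norm (x - xp) i
  have hei : ∀ i, ‖Y i - mean Y‖ ≤ e := fun i =>
    (norm_le_pi_norm (Y - fun _ => mean Y) i).trans (he ▸ hν _)
  set T : X → X := fun x => F (ξ + mean fun j => φ j x) with hT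
  have hYT : ∀ i, ‖Y i - (ξ + mean fun j => φ j (x i₀))‖ ≤ e + L * (D + s) := by
    intro i
    have e1 : Y i - (ξ + mean fun j => φ j (x i₀))
        = (Y i - mean Y) + ((mean fun j => φ j (xp j)) - mean fun j => φ j (x i₀)) := by
      rw [hmean]; abel
    rw [e1]
    refine (norm_add_le _ _).trans (add_le_add (hei i) ?_)
    refine h.mean_lip hxp (fun _ => hx i₀) (by positivity) fun j => ?_
    calc ‖xp j - x i₀‖ = ‖-(x j - xp j) + (x j - x i₀)‖ := by congr 1; abel
      _ ≤ D + s := (norm_add_le _ _).trans (add_le_add (by rw [norm_neg]; exact hDi j) (hsi j))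
  have hFT : ∀ i, ‖F (Y i) - T (x i₀)‖ ≤ L * (e + L * (D + s)) := fun i =>
    (h.F_lip _ _ (hY i) hYx).trans (mul_le_mul_of_nonneg_left (hYT i) hL.le)
  have hSn := norm_nonneg S
  have hd := hS (x i₀ - xh)
  rw [← hm] at hd
  refine ⟨?_, ?_, ?_, ?_⟩
  -- Linear Euler step, plus linearization error, plus tracking error of Y. The linearization error
  -- uses up half of the rate μ, through hδ.
  · have e1 : x' i₀ - xh = ((1 - ε) • (x i₀ - xh) + ε • B (x i₀ - xh))
        + ε • (T (x i₀) - T xh - B (x i₀ - xh)) + ε • (F (Y i₀) - T (x i₀)) := by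
      have : T xh = xh := hfix
      rw [hx', this]; module
    have h1 := hB (x i₀ - xh)
    rw [← hm] at h1
    have h2 : ‖S (ε • (T (x i₀) - T xh - B (x i₀ - xh)))‖ ≤ ε * (μ / 2) * m := by
      rw [map_smul, norm_smul, Real.norm_of_nonneg hε.le, mul_assoc]
      refine mul_le_mul_of_nonneg_left ?_ hε.le
      rcases eq_or_ne (x i₀) xh with h0 | h0
      · rw [h0, sub_self, sub_self, map_zero, sub_zero, map_zero, norm_zero]
        have : 0 ≤ μ / 2 * m := by rw [hm, h0, sub_self, map_zero, norm_zero, mul_zero]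
        exact this
      have hδ0 : 0 ≤ δ := by
        have := (norm_nonneg _).trans (h.lin ξ (x i₀) xh hξR (hx i₀) hxh)
        exact nonneg_of_mul_nonneg_left this (norm_pos_iff.2 (sub_ne_zero.2 h0))
      calc ‖S (T (x i₀) - T xh - B (x i₀ - xh))‖
          ≤ ‖S‖ * (δ * ‖x i₀ - xh‖) := (S.le_opNorm _).trans
            (mul_le_mul_of_nonneg_left (h.lin ξ _ _ hξR (hx i₀) hxh) hSn)
        _ ≤ ‖S‖ * (δ * (CS * m)) := by gcongr
        _ = ‖S‖ * δ * CS * m := by ring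
        _ ≤ μ / 2 * m := mul_le_mul_of_nonneg_right hδ hm0
    have h3 : ‖S (ε • (F (Y i₀) - T (x i₀)))‖ ≤ ε * (‖S‖ * (L * (e + L * (D + s)))) := by
      rw [map_smul, norm_smul, Real.norm_of_nonneg hε.le]
      refine mul_le_mul_of_nonneg_left ?_ hε.le
      exact (S.le_opNorm _).trans (mul_le_mul_of_nonneg_left (hFT i₀) hSn)
    have h4 : ‖S‖ * (L * (e + L * (D + s))) ≤ Λ * (s + e + D) := by
      have h5 : 0 ≤ 2 * L + C * L + L ^ 2 + (L ^ 2 + 1) * CS + 1 := by positivity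
      have h6 : 0 ≤ ‖S‖ * L := by positivity
      have h7 : 0 ≤ ‖S‖ * L ^ 2 := by positivity
      have a1 : ‖S‖ * L ≤ Λ := by linarith
      have a2 : ‖S‖ * L ^ 2 ≤ Λ := by linarith
      calc ‖S‖ * (L * (e + L * (D + s))) = ‖S‖ * L * e + ‖S‖ * L ^ 2 * (D + s) := by ring
        _ ≤ Λ * e + Λ * (D + s) := by gcongr
        _ = Λ * (s + e + D) := by ring
    rw [hm', e1, map_add, map_add]
    have h5 := norm_add₃_le (a := S ((1 - ε) • (x i₀ - xh) + ε • B (x i₀ - xh)))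
      (b := S (ε • (T (x i₀) - T xh - B (x i₀ - xh)))) (c := S (ε • (F (Y i₀) - T (x i₀))))
    have h6 := mul_le_mul_of_nonneg_left h4 hε.le
    linarith
  · rw [hs']
    have hΛ2 : 2 * L ≤ Λ := by
      rw [hΛ]
      have : 0 ≤ ‖S‖ * L + ‖S‖ * L ^ 2 + C * L + L ^ 2 + (L ^ 2 + 1) * CS + 1 := by positivity
      linarith
    have hΛ0 : 0 ≤ Λ := by linarith
    have h1ε : 0 ≤ 1 - ε := by linarith
    refine (pi_norm_le_iff_of_nonneg (by positivity)).2 fun i => ?_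
    have e1 : x' i - x' i₀ = (1 - ε) • (x i - x i₀) + ε • (F (Y i) - F (Y i₀)) := by
      rw [hx', hx']; module
    have h1 : ‖F (Y i) - F (Y i₀)‖ ≤ L * (e + e) := by
      refine (h.F_lip _ _ (hY i) (hY i₀)).trans (mul_le_mul_of_nonneg_left ?_ hL.le)
      calc ‖Y i - Y i₀‖ = ‖(Y i - mean Y) - (Y i₀ - mean Y)‖ := by congr 1; abel
        _ ≤ e + e := (norm_sub_le _ _).trans (add_le_add (hei i) (hei i₀))
    rw [e1]
    refine (norm_add_le _ _).trans (add_le_add ?_ ?_)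
    · rw [norm_smul, Real.norm_of_nonneg h1ε]
      exact mul_le_mul_of_nonneg_left (hsi i) h1ε
    · rw [norm_smul, Real.norm_of_nonneg hε.le, mul_assoc]
      refine mul_le_mul_of_nonneg_left (h1.trans ?_) hε.le
      calc L * (e + e) = 2 * L * e := by ring
        _ ≤ Λ * e := by gcongr
  · have hΛ3 : C * L ≤ Λ := by
      rw [hΛ]
      have : 0 ≤ ‖S‖ * L + ‖S‖ * L ^ 2 + 2 * L + L ^ 2 + (L ^ 2 + 1) * CS + 1 := by positivity
      linarith
    rw [he', hY', hP.mix_sub_mean]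
    have h1 : ‖(fun i => φ i (x i)) - fun i => φ i (xp i)‖ ≤ L * D :=
      (pi_norm_le_iff_of_nonneg (by positivity)).2 fun i =>
        (h.φ_lip i _ _ (hx i) (hxp i)).trans (mul_le_mul_of_nonneg_left (hDi i) hL.le)
    calc _ ≤ ρ * ν ((Y - fun _ => mean Y) + ((fun i => φ i (x i)) - fun i => φ i (xp i))) :=
          hνρ _
      _ ≤ ρ * (e + C * (L * D)) := by
        gcongr
        refine (map_add_le_add _ _ _).trans (add_le_add he.ge ((hνC _).trans ?_))
        gcongr
      _ ≤ ρ * e + 1 * (C * (L * D)) := by rw [mul_add]; gcongr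
      _ = ρ * e + C * L * D := by ring
      _ ≤ ρ * e + Λ * D := by gcongr
  · have hΛ4 : L ≤ Λ ∧ L ^ 2 + 1 ≤ Λ ∧ (L ^ 2 + 1) * CS ≤ Λ := by
      rw [hΛ]
      have h1 : 0 ≤ ‖S‖ * L + ‖S‖ * L ^ 2 + C * L := by positivity
      have h2 : 0 ≤ (L ^ 2 + 1) * CS := by positivity
      have h3 : 0 ≤ L ^ 2 := by positivity
      refine ⟨?_, ?_, ?_⟩ <;> linarith
    have hΛ0 : 0 ≤ Λ := by linarith [hΛ4.1]
    rw [hD']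
    refine (pi_norm_le_iff_of_nonneg (by positivity)).2 fun i => ?_
    have hTT : ‖T (x i₀) - T xh‖ ≤ L * (L * ‖x i₀ - xh‖) := by
      refine (h.F_lip _ _ hYx hξR₂).trans (mul_le_mul_of_nonneg_left ?_ hL.le)
      rw [add_sub_add_left_eq_sub]
      exact h.mean_lip (fun _ => hx i₀) (fun _ => hxh) (norm_nonneg _) fun _ => le_rfl
    -- A move is ε (F(Y i) - x i); inserting T(x i₀), xh = T(xh) and x i₀ bounds it by the four
    -- errors.
    have e1 : (x' - x) i = ε • ((F (Y i) - T (x i₀)) + (T (x i₀) - T xh) + (xh - x i₀)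
        + (x i₀ - x i)) := by
      have : T xh = xh := hfix
      rw [Pi.sub_apply, hx', this]; module
    rw [e1, norm_smul, Real.norm_of_nonneg hε.le, mul_assoc]
    refine mul_le_mul_of_nonneg_left ?_ hε.le
    have h1 := norm_add₄_le (a := F (Y i) - T (x i₀)) (b := T (x i₀) - T xh) (c := xh - x i₀)
      (d := x i₀ - x i)
    have h2 := hFT i
    have h3 := hsi i
    rw [norm_sub_rev] at h3
    rw [norm_sub_rev xh] at h1
    have h4 : (L ^ 2 + 1) * ‖x i₀ - xh‖ ≤ Λ * m := by
      calc _ ≤ (L ^ 2 + 1) * (CS * m) := by gcongr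
        _ = (L ^ 2 + 1) * CS * m := by ring
        _ ≤ Λ * m := by gcongr; exact hΛ4.2.2
    have h5 : L * e ≤ Λ * e := mul_le_mul_of_nonneg_right hΛ4.1 he0
    have h6 : (L ^ 2 + 1) * s ≤ Λ * s := mul_le_mul_of_nonneg_right hΛ4.2.1 hs0
    have h7 : (L ^ 2 + 1) * D ≤ Λ * D := mul_le_mul_of_nonneg_right hΛ4.2.1 hD0
    nlinarith

end orbit
section orbit
variable {N : ℕ} {X E : Type*} [NormedAddCommGroup X] [NormedSpace ℝ X]
  [NormedAddCommGroup E] [NormedSpace ℝ E]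

set_option maxHeartbeats 1000000 in
-- A bootstrap: while U ≤ r₀, all arguments stay where the local estimates hold, so U shrinks and
-- the bound persists. The perturbation may be read at time 0, although smallness is assumed only
-- around k₀, because it is conserved.
theorem LocalData.local_convergence {G : SimpleGraph (Fin N)} {P : Matrix (Fin N) (Fin N) ℝ}
    (hP : IsConsensusMatrix G P)
    {φ : Fin N → X → E} {F : E → X} {B : X →L[ℝ] X} {xs : X} {p : E}
    (hp : p = mean fun j => φ j xs)
    {L R δ : ℝ} (h : LocalData φ F B xs p L R δ)
    {S : X →L[ℝ] X} {CS : ℝ} (hCS : 0 ≤ CS) (hS : ∀ d, ‖d‖ ≤ CS * ‖S d‖) {μ ε₁ : ℝ}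
    (hμ : 0 < μ) (hμ1 : μ ≤ 1) (hε₁ : 0 < ε₁)
    (hB : ∀ ε, 0 < ε → ε < ε₁ → ∀ d, ‖S ((1 - ε) • d + ε • B d)‖ ≤ (1 - ε * μ) * ‖S d‖)
    (hδ : ‖S‖ * δ * CS ≤ μ / 2) :
    ∃ r₁ ε₂ : ℝ, 0 < r₁ ∧ 0 < ε₂ ∧ ∀ ε, 0 < ε → ε < ε₂ → ∀ x Y V, IsOrbit P φ F ε x Y V →
      ∀ xh, ‖mean (Y 0 - V 0)‖ ≤ r₁ → ‖xh - xs‖ ≤ r₁ →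
      F (mean (Y 0 - V 0) + mean fun j => φ j xh) = xh →
      ∀ k₀, (∀ i, ‖x (k₀ + 1) i - xs‖ ≤ r₁) → (∀ i, ‖x k₀ i - xs‖ ≤ r₁) →
      ‖Y (k₀ + 1) - fun _ => mean (Y (k₀ + 1))‖ ≤ r₁ →
      ∀ i, Tendsto (fun k => x k i) atTop (𝓝 xh) := by
  obtain ⟨n, ρ, C, hρ, hρ1, hC, hn, hnC, hnρ⟩ := hP.exists_contracting_seminorm (E := E)
  have hL := h.L_pos
  have hR := h.R_pos
  obtain ⟨Λ, hΛ⟩ : ∃ Λ, Λ = ‖S‖ * L + ‖S‖ * L ^ 2 + 2 * L + C * L + L ^ 2 + (L ^ 2 + 1) * CS + 1 :=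
    ⟨_, rfl⟩
  have hΛ0 : 0 < Λ := by rw [hΛ]; positivity
  obtain ⟨α, β, γ, η, ε₀, hα, hβ, hγ, hη, hε₀, hstep⟩ :=
    exists_lyapunov_weights (half_pos hμ) (by linarith) hρ1 hΛ0
  obtain ⟨κ, hκ⟩ : ∃ κ, κ = CS + 1 / α + 1 / β + 1 / γ := ⟨_, rfl⟩
  have hκ0 : 0 < κ := by rw [hκ]; positivity
  have iα : 0 < 1 / α := by positivity
  have iβ : 0 < 1 / β := by positivity
  have iγ : 0 < 1 / γ := by positivity
  -- Estimates will lie within 2Q of xs, the mean of Y within Q + 2LQ of p, and each Y i within Q/3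
  -- of that mean; Q keeps all of this inside R.
  obtain ⟨Q, hQ⟩ : ∃ Q, Q = R / (4 * (1 + L)) := ⟨_, rfl⟩
  have hQ0 : 0 < Q := by rw [hQ]; positivity
  have hQR : (1 + L) * (4 * Q) = R := by rw [hQ]; field_simp
  obtain ⟨r₀, hr₀⟩ : ∃ r₀, r₀ = Q / (3 * κ) := ⟨_, rfl⟩
  have hr₀0 : 0 < r₀ := by rw [hr₀]; positivity
  have hκr : κ * r₀ = Q / 3 := by rw [hr₀]; field_simp
  obtain ⟨W, hW⟩ : ∃ W, W = ‖S‖ * 2 + α * 2 + β * C + γ * 2 := ⟨_, rfl⟩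
  have hW0 : 0 < W := by rw [hW]; positivity
  refine ⟨min Q (r₀ / W), min (min ε₀ ε₁) (min 1 (1 / η)), by positivity, by positivity, ?_⟩
  intro ε hε hεlt x Y V ho xh hξ hxh hfix k₀ hx1 hx0 hY1
  have hεε₀ : ε < ε₀ := hεlt.trans_le ((min_le_left _ _).trans (min_le_left _ _))
  have hεε₁ : ε < ε₁ := hεlt.trans_le ((min_le_left _ _).trans (min_le_right _ _))
  have hε1 : ε < 1 := hεlt.trans_le ((min_le_right _ _).trans (min_le_left _ _))
  have hεη : ε * η < 1 := (lt_div_iff₀ hη).1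
    (hεlt.trans_le ((min_le_right _ _).trans (min_le_right _ _)))
  obtain ⟨r₁, hr₁⟩ : ∃ r₁, r₁ = min Q (r₀ / W) := ⟨_, rfl⟩
  rw [← hr₁] at hξ hxh hx1 hx0 hY1
  have hr₁Q : r₁ ≤ Q := hr₁ ▸ min_le_left _ _
  have hr₁W : r₁ * W ≤ r₀ := (le_div_iff₀ hW0).1 (hr₁ ▸ min_le_right _ _)
  have hr₁0 : 0 ≤ r₁ := (norm_nonneg _).trans hξ
  obtain ⟨ξ, hξdef⟩ : ∃ ξ, ξ = mean (Y 0 - V 0) := ⟨_, rfl⟩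
  rw [← hξdef] at hξ hfix
  have hLQ : 0 < L * Q := by positivity
  have hQR' : Q ≤ R := by linarith
  obtain ⟨i₀⟩ := hP.connected.nonempty
  -- Indices start at k₀ + 1: only from time 1 on do the registers hold φ at the previous estimates.
  let m : ℕ → ℝ := fun k => ‖S (x (k₀ + k + 1) i₀ - xh)‖
  let s : ℕ → ℝ := fun k => ‖fun i => x (k₀ + k + 1) i - x (k₀ + k + 1) i₀‖
  let e : ℕ → ℝ := fun k => n (Y (k₀ + k + 1) - fun _ => mean (Y (k₀ + k + 1)))
  let D : ℕ → ℝ := fun k => ‖x (k₀ + k + 1) - x (k₀ + k)‖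
  let U : ℕ → ℝ := fun k => m k + α * s k + β * e k + γ * D k
  have hm0 : ∀ k, 0 ≤ m k := fun k => norm_nonneg _
  have hs0 : ∀ k, 0 ≤ s k := fun k => norm_nonneg _
  have he0 : ∀ k, 0 ≤ e k := fun k => apply_nonneg _ _
  have hD0 : ∀ k, 0 ≤ D k := fun k => norm_nonneg _
  have bm : ∀ k, m k ≤ U k := fun k => by
    have := mul_nonneg hα.le (hs0 k); have := mul_nonneg hβ.le (he0 k)
    have := mul_nonneg hγ.le (hD0 k)
    simp only [U]; linarith
  have hU0 : ∀ k, 0 ≤ U k := fun k => (hm0 k).trans (bm k)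
  have bs : ∀ k, s k ≤ 1 / α * U k := fun k => by
    have := mul_nonneg hα.le (hs0 k); have := mul_nonneg hβ.le (he0 k)
    have := mul_nonneg hγ.le (hD0 k); have := hm0 k
    rw [one_div_mul_eq_div, le_div_iff₀ hα]
    simp only [U]; linarith
  have be : ∀ k, e k ≤ 1 / β * U k := fun k => by
    have := mul_nonneg hα.le (hs0 k); have := mul_nonneg hβ.le (he0 k)
    have := mul_nonneg hγ.le (hD0 k); have := hm0 k
    rw [one_div_mul_eq_div, le_div_iff₀ hβ]
    simp only [U]; linarith
  have bD : ∀ k, D k ≤ 1 / γ * U k := fun k => by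
    have := mul_nonneg hα.le (hs0 k); have := mul_nonneg hβ.le (he0 k)
    have := mul_nonneg hγ.le (hD0 k); have := hm0 k
    rw [one_div_mul_eq_div, le_div_iff₀ hγ]
    simp only [U]; linarith
  have hxU : ∀ k i, ‖x (k₀ + k + 1) i - xh‖ ≤ κ * U k := fun k i => by
    have h1 : ‖x (k₀ + k + 1) i₀ - xh‖ ≤ CS * U k :=
      (hS _).trans (mul_le_mul_of_nonneg_left (bm k) hCS)
    have h2 : ‖x (k₀ + k + 1) i - x (k₀ + k + 1) i₀‖ ≤ s k :=
      norm_le_pi_norm (fun i => x (k₀ + k + 1) i - x (k₀ + k + 1) i₀) i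
    have h3 := norm_sub_le_norm_sub_add_norm_sub (x (k₀ + k + 1) i) (x (k₀ + k + 1) i₀) xh
    have h4 := mul_nonneg iβ.le (hU0 k)
    have h5 := mul_nonneg iγ.le (hU0 k)
    have := bs k
    rw [hκ]; linarith
  have hDU : ∀ k, D k ≤ κ * U k := fun k => by
    have h4 := mul_nonneg iβ.le (hU0 k)
    have h5 := mul_nonneg iα.le (hU0 k)
    have := mul_nonneg hCS (hU0 k)
    have := bD k
    rw [hκ]; linarith
  have heU : ∀ k, e k ≤ κ * U k := fun k => by
    have h4 := mul_nonneg iγ.le (hU0 k)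
    have h5 := mul_nonneg iα.le (hU0 k)
    have := mul_nonneg hCS (hU0 k)
    have := be k
    rw [hκ]; linarith
  have hdec : ∀ k, U k ≤ r₀ → U (k + 1) ≤ (1 - ε * η) * U k := by
    intro k hk
    have hκU : κ * U k ≤ Q / 3 := hκr ▸ mul_le_mul_of_nonneg_left hk hκ0.le
    have hx : ∀ i, ‖x (k₀ + k + 1) i - xs‖ ≤ 2 * Q := fun i => by
      have := norm_sub_le_norm_sub_add_norm_sub (x (k₀ + k + 1) i) xh xs
      have := hxU k i
      linarith
    have hxp : ∀ i, ‖x (k₀ + k) i - xs‖ ≤ 2 * Q := fun i => by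
      have h1 : ‖x (k₀ + k + 1) i - x (k₀ + k) i‖ ≤ D k :=
        norm_le_pi_norm (x (k₀ + k + 1) - x (k₀ + k)) i
      have h2 := norm_sub_le_norm_sub_add_norm_sub (x (k₀ + k) i) (x (k₀ + k + 1) i) xs
      have h3 := norm_sub_le_norm_sub_add_norm_sub (x (k₀ + k + 1) i) xh xs
      rw [norm_sub_rev (x (k₀ + k) i) (x (k₀ + k + 1) i)] at h2
      have := hxU k i
      have := hDU k
      linarith
    have h2QR : 2 * Q ≤ R := by linarith
    have hxR : ∀ i, ‖x (k₀ + k + 1) i - xs‖ ≤ R := fun i => (hx i).trans h2QR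
    have hxpR : ∀ i, ‖x (k₀ + k) i - xs‖ ≤ R := fun i => (hxp i).trans h2QR
    have hbase : ∀ z : Fin N → X, (∀ j, ‖z j - xs‖ ≤ 2 * Q) →
        ‖(ξ + mean fun j => φ j (z j)) - p‖ ≤ Q + L * (2 * Q) := fun z hz => by
      rw [hp, add_sub_assoc]
      refine (norm_add_le _ _).trans (add_le_add (hξ.trans hr₁Q) ?_)
      exact h.mean_lip (fun j => (hz j).trans h2QR) (fun j => by simpa using hR.le)
        (by positivity) hz
    have hmean : mean (Y (k₀ + k + 1)) = ξ + mean fun j => φ j (x (k₀ + k) j) := by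
      rw [ho.mean_sub hP, ← hξdef, show V (k₀ + k + 1) = _ from funext (ho.V_succ (k₀ + k))]
    have hY : ∀ i, ‖Y (k₀ + k + 1) i - p‖ ≤ R := fun i => by
      have h1 : ‖Y (k₀ + k + 1) i - mean (Y (k₀ + k + 1))‖ ≤ e k :=
        (norm_le_pi_norm (Y (k₀ + k + 1) - fun _ => mean (Y (k₀ + k + 1))) i).trans (hn _)
      have h2 := hbase _ hxp
      rw [← hmean] at h2
      have h3 := norm_sub_le_norm_sub_add_norm_sub (Y (k₀ + k + 1) i) (mean (Y (k₀ + k + 1))) p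
      have := heU k
      linarith
    have hQ2 : Q + L * (2 * Q) ≤ R := by linarith
    have hYs := ho.Y_succ (k₀ + k + 1)
    rw [show V (k₀ + k + 1) = _ from funext (ho.V_succ (k₀ + k))] at hYs
    have hest := step_estimates hP h hρ hρ1.le (by linarith) hn hnC hnρ hCS hS hε hε1.le
      (hB ε hε hεε₁) hδ hΛ i₀ hfix hmean (hξ.trans (hr₁Q.trans hQR')) (hxh.trans (hr₁Q.trans hQR'))
      ((hbase (fun _ => xh) fun _ => hxh.trans (by linarith)).trans hQ2) hxR hxpR hY
      ((hbase (fun _ => x (k₀ + k + 1) i₀) fun _ => hx i₀).trans hQ2)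
      (ho.x_succ (k₀ + k + 1))
      hYs
      (m := m k) (s := s k) (e := e k) (D := D k) (m' := m (k + 1)) (s' := s (k + 1))
      (e' := e (k + 1)) (D' := D (k + 1)) rfl rfl rfl rfl rfl rfl rfl rfl
    exact hstep ε hε hεε₀ _ _ _ _ _ _ _ _ (hm0 k) (hs0 k) (he0 k) (hD0 k) hest.1 hest.2.1
      hest.2.2.1 hest.2.2.2
  have hU_init : U 0 ≤ r₀ := by
    have h1 : m 0 ≤ ‖S‖ * (2 * r₁) := by
      refine (S.le_opNorm _).trans (mul_le_mul_of_nonneg_left ?_ (norm_nonneg _))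
      have := norm_sub_le_norm_sub_add_norm_sub (x (k₀ + 0 + 1) i₀) xs xh
      rw [norm_sub_rev xs] at this
      have := hx1 i₀
      simp only [add_zero] at *
      linarith
    have h2 : s 0 ≤ 2 * r₁ := by
      refine (pi_norm_le_iff_of_nonneg (by positivity)).2 fun i => ?_
      have := norm_sub_le_norm_sub_add_norm_sub (x (k₀ + 0 + 1) i) xs (x (k₀ + 0 + 1) i₀)
      rw [norm_sub_rev xs] at this
      have := hx1 i₀
      have := hx1 i
      simp only [add_zero] at *
      linarith
    have h3 : e 0 ≤ C * r₁ :=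
      (hnC _).trans (mul_le_mul_of_nonneg_left hY1 (by linarith))
    have h4 : D 0 ≤ 2 * r₁ := by
      refine (pi_norm_le_iff_of_nonneg (by positivity)).2 fun i => ?_
      have := norm_sub_le_norm_sub_add_norm_sub (x (k₀ + 0 + 1) i) xs (x (k₀ + 0) i)
      rw [norm_sub_rev xs] at this
      have := hx1 i
      have := hx0 i
      simp only [add_zero, Pi.sub_apply] at *
      linarith
    have h2' := mul_le_mul_of_nonneg_left h2 hα.le
    have h3' := mul_le_mul_of_nonneg_left h3 hβ.le
    have h4' := mul_le_mul_of_nonneg_left h4 hγ.le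
    rw [hW] at hr₁W
    simp only [U]
    linarith
  have hq0 : 0 ≤ 1 - ε * η := by linarith
  have hq1 : 1 - ε * η < 1 := by have := mul_pos hε hη; linarith
  have hU : ∀ k, U k ≤ (1 - ε * η) ^ k * r₀ := by
    intro k
    induction k with
    | zero => simpa using hU_init
    | succ k ih =>
      have hk : U k ≤ r₀ := ih.trans (mul_le_of_le_one_left hr₀0.le (pow_le_one₀ hq0 hq1.le))
      calc U (k + 1) ≤ (1 - ε * η) * U k := hdec k hk
        _ ≤ (1 - ε * η) * ((1 - ε * η) ^ k * r₀) := mul_le_mul_of_nonneg_left ih hq0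
        _ = (1 - ε * η) ^ (k + 1) * r₀ := by ring
  intro i
  rw [← tendsto_add_atTop_iff_nat (k₀ + 1), tendsto_iff_norm_sub_tendsto_zero]
  have hlim : Tendsto (fun k : ℕ => κ * ((1 - ε * η) ^ k * r₀)) atTop (𝓝 (κ * (0 * r₀))) :=
    ((tendsto_pow_atTop_nhds_zero_of_lt_one hq0 hq1).mul_const _).const_mul _
  rw [zero_mul, mul_zero] at hlim
  refine squeeze_zero (fun _ => norm_nonneg _) (fun k => ?_) hlim
  have := (hxU k i).trans (mul_le_mul_of_nonneg_left (hU k) hκ0.le)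
  rwa [show k₀ + k + 1 = k + (k₀ + 1) by ring] at this

/-! ### The initial transient. -/

set_option maxHeartbeats 1000000 in
/-- After a number of iterations that does not depend on the step size, the orbit is as close to
consensus as desired, while the estimates have hardly moved. -/
theorem LocalData.transient {G : SimpleGraph (Fin N)} {P : Matrix (Fin N) (Fin N) ℝ}
    (hP : IsConsensusMatrix G P)
    {φ : Fin N → X → E} {F : E → X} {B : X →L[ℝ] X} {xs : X} {p : E}
    {L R δ : ℝ} (h : LocalData φ F B xs p L R δ) {CF : ℝ} (hCF : 0 ≤ CF)
    (hF : ∀ y, ‖F y‖ ≤ CF * ‖y‖) {r₁ : ℝ} (hr₁ : 0 < r₁) :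
    ∃ r₂ : ℝ, 0 < r₂ ∧ ∀ r, 0 < r → r ≤ r₂ → ∃ ε₂ : ℝ, 0 < ε₂ ∧
      ∃ k₀ : ℕ, ∀ ε, 0 < ε → ε < ε₂ → ∀ x Y V,
      IsOrbit P φ F ε x Y V → (∀ i, ‖x 0 i - xs‖ ≤ r) → (∀ i, ‖Y 0 i - p‖ ≤ r) →
      (∀ i, ‖V 0 i - p‖ ≤ r) →
      (∀ i, ‖x (k₀ + 1) i - xs‖ ≤ r₁) ∧ (∀ i, ‖x k₀ i - xs‖ ≤ r₁) ∧
        ‖Y (k₀ + 1) - fun _ => mean (Y (k₀ + 1))‖ ≤ r₁ := by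
  obtain ⟨n, ρ, C, hρ, hρ1, hC, hn, hnC, hnρ⟩ := hP.exists_contracting_seminorm (E := E)
  have hL := h.L_pos
  have hR := h.R_pos
  have hC0 : 0 < C := by linarith
  refine ⟨min (min (r₁ / 2) (R / 2)) 1, by positivity, fun r hr hrr => ?_⟩
  have hrr₁ : 2 * r ≤ r₁ := by
    have := hrr.trans ((min_le_left _ _).trans (min_le_left _ _)); linarith
  have hrR : 2 * r ≤ R := by
    have := hrr.trans ((min_le_left _ _).trans (min_le_right _ _)); linarith
  have hr1 : r ≤ 1 := hrr.trans (min_le_right _ _)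
  obtain ⟨Φ, hΦ⟩ : ∃ Φ, Φ = ‖fun i => φ i xs‖ := ⟨_, rfl⟩
  have hΦ0 : 0 ≤ Φ := hΦ ▸ norm_nonneg _
  -- A bounds the disagreement plus input of the first round; it contains the norm Φ of the family
  -- φ_i(xs), which does not shrink with r. Bd bounds ‖F(Y i) - x i‖ through the global growth of F,
  -- as Y may leave the region where F is known to be Lipschitz.
  obtain ⟨A, hA⟩ : ∃ A, A = C * (4 + Φ + L * R + ‖p‖ + 1) := ⟨_, rfl⟩
  have hA0 : 0 < A := by rw [hA]; positivity
  obtain ⟨Bd, hBd⟩ : ∃ Bd, Bd = CF * (A + 1 + 2 + Φ + L * R + ‖p‖ + 1) + (‖xs‖ + R) + 1 :=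
    ⟨_, rfl⟩
  have hBd0 : 0 < Bd := by rw [hBd]; positivity
  have h1ρ : 0 < 1 - ρ := by linarith
  obtain ⟨k₀, hk₀⟩ : ∃ k₀ : ℕ, ρ ^ k₀ * A < r₁ / 2 := by
    have : Tendsto (fun k : ℕ => ρ ^ k * A) atTop (𝓝 (0 * A)) :=
      (tendsto_pow_atTop_nhds_zero_of_lt_one hρ.le hρ1).mul_const _
    rw [zero_mul] at this
    exact (this.eventually (gt_mem_nhds (half_pos hr₁))).exists
  -- Since ρτ + (1 - ρ)τ = τ, inputs of size at most τ(1 - ρ) per round sustain a disagreement of at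
  -- most τ. The second bound on ε below ensures this; the first keeps x within 2r of xs up to time
  -- k₀ + 1.
  obtain ⟨τ, hτ⟩ : ∃ τ, τ = min 1 (r₁ / 2) := ⟨_, rfl⟩
  have hτ0 : 0 < τ := by rw [hτ]; positivity
  have hτ1 : τ ≤ 1 := hτ ▸ min_le_left _ _
  have hτr : τ ≤ r₁ / 2 := hτ ▸ min_le_right _ _
  refine ⟨min (r / (Bd * (k₀ + 1))) (τ * (1 - ρ) / (C * L * Bd)), by positivity, k₀, ?_⟩
  intro ε hε hεlt x Y V ho hx0 hY0 hV0
  have hεB : ε * (Bd * (k₀ + 1)) < r :=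
    (lt_div_iff₀ (by positivity)).1 (hεlt.trans_le (min_le_left _ _))
  have hετ : ε * (C * L * Bd) < τ * (1 - ρ) :=
    (lt_div_iff₀ (by positivity)).1 (hεlt.trans_le (min_le_right _ _))
  have hξ : ‖mean (Y 0 - V 0)‖ ≤ 2 := by
    refine (norm_mean_le _).trans ((pi_norm_le_iff_of_nonneg (by norm_num)).2 fun i => ?_)
    have := norm_sub_le_norm_sub_add_norm_sub (Y 0 i) p (V 0 i)
    rw [norm_sub_rev p] at this
    have := hY0 i
    have := hV0 i
    rw [Pi.sub_apply]
    linarith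
  have hφ : ∀ z : Fin N → X, (∀ i, ‖z i - xs‖ ≤ R) → ‖fun i => φ i (z i)‖ ≤ Φ + L * R := by
    intro z hz
    refine (pi_norm_le_iff_of_nonneg (by positivity)).2 fun i => ?_
    have h1 := h.φ_lip i (z i) xs (hz i) (by simpa using hR.le)
    have h2 : ‖φ i xs‖ ≤ Φ := hΦ ▸ norm_le_pi_norm (fun i => φ i xs) i
    have h3 := mul_le_mul_of_nonneg_left (hz i) hL.le
    have h4 := norm_le_norm_add_norm_sub' (φ i (z i)) (φ i xs)
    linarith
  -- one step in terms of the size of `Y`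
  have hD : ∀ k, (∀ i, ‖x k i - xs‖ ≤ R) → (∀ i, ‖Y k i‖ ≤ A + 1 + 2 + Φ + L * R + ‖p‖ + 1) →
      ∀ i, ‖x (k + 1) i - x k i‖ ≤ ε * Bd := by
    intro k hxk hYk i
    have e1 : x (k + 1) i - x k i = ε • (F (Y k i) - x k i) := by rw [ho.x_succ]; module
    rw [e1, norm_smul, Real.norm_of_nonneg hε.le]
    refine mul_le_mul_of_nonneg_left ?_ hε.le
    have h1 := (hF (Y k i)).trans (mul_le_mul_of_nonneg_left (hYk i) hCF)
    have h2 := norm_le_norm_add_norm_sub' (x k i) xs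
    have h3 := hxk i
    have h4 := norm_sub_le (F (Y k i)) (x k i)
    rw [hBd]; linarith
  have key : ∀ k : ℕ, k ≤ k₀ → (∀ i, ‖x k i - xs‖ ≤ r + k * (ε * Bd)) ∧
      (∀ i, ‖x (k + 1) i - x k i‖ ≤ ε * Bd) ∧
      n (Y (k + 1) - fun _ => mean (Y (k + 1))) ≤ ρ ^ k * A + τ := by
    have hsmall : ∀ k : ℕ, k ≤ k₀ + 1 → r + k * (ε * Bd) ≤ 2 * r := fun k hk => by
      have : (k : ℝ) ≤ k₀ + 1 := by exact_mod_cast hk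
      have : k * (ε * Bd) ≤ (k₀ + 1) * (ε * Bd) := by gcongr
      linarith
    intro k
    induction k with
    | zero =>
      intro _
      have hx0R : ∀ i, ‖x 0 i - xs‖ ≤ R := fun i => (hx0 i).trans (by linarith)
      refine ⟨fun i => by simpa using hx0 i, hD 0 hx0R fun i => ?_, ?_⟩
      · have h1 := norm_le_norm_add_norm_sub' (Y 0 i) p
        have h2 := hY0 i
        have : 0 ≤ L * R := by positivity
        linarith
      · rw [ho.Y_succ, hP.mix_sub_mean]
        refine (hnρ _).trans ?_
        have h1 : n ((Y 0 - fun _ => mean (Y 0)) + ((fun i => φ i (x 0 i)) - V 0)) ≤ A := by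
          refine (hnC _).trans ?_
          rw [hA]
          refine mul_le_mul_of_nonneg_left ?_ hC0.le
          refine (pi_norm_le_iff_of_nonneg (by positivity)).2 fun i => ?_
          have e1 : ((Y 0 - fun _ => mean (Y 0)) + ((fun i => φ i (x 0 i)) - V 0) : Fin N → E) i
              = (Y 0 i - V 0 i) - mean (Y 0 - V 0) - mean (V 0) + φ i (x 0 i) := by
            rw [mean_sub]; simp only [Pi.add_apply, Pi.sub_apply]; abel
          rw [e1]
          have a1 := norm_sub_le_norm_sub_add_norm_sub (Y 0 i) p (V 0 i)
          rw [norm_sub_rev p] at a1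
          have a2 : ‖mean (V 0)‖ ≤ ‖p‖ + 1 :=
            (norm_mean_le _).trans ((pi_norm_le_iff_of_nonneg (by positivity)).2 fun j => by
              have := norm_le_norm_add_norm_sub' (V 0 j) p
              have := hV0 j
              linarith)
          have a3 := (norm_le_pi_norm (fun i => φ i (x 0 i)) i).trans (hφ _ hx0R)
          have a4 := norm_add_le ((Y 0 i - V 0 i) - mean (Y 0 - V 0) - mean (V 0)) (φ i (x 0 i))
          have a5 := norm_sub_le ((Y 0 i - V 0 i) - mean (Y 0 - V 0)) (mean (V 0))
          have a6 := norm_sub_le (Y 0 i - V 0 i) (mean (Y 0 - V 0))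
          have a7 := hY0 i
          have a8 := hV0 i
          linarith
        calc ρ * n _ ≤ 1 * A := mul_le_mul hρ1.le h1 (apply_nonneg _ _) zero_le_one
          _ ≤ ρ ^ 0 * A + τ := by rw [pow_zero]; linarith
    | succ k ih =>
      intro hk
      obtain ⟨ih1, ih2, ih3⟩ := ih (by omega)
      have hxk : ∀ i, ‖x k i - xs‖ ≤ R := fun i =>
        (ih1 i).trans ((hsmall k (by omega)).trans hrR)
      have hxk1 : ∀ i, ‖x (k + 1) i - xs‖ ≤ r + (k + 1 : ℕ) * (ε * Bd) := fun i => by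
        have := norm_sub_le_norm_sub_add_norm_sub (x (k + 1) i) (x k i) xs
        have := ih1 i
        have := ih2 i
        push_cast
        linarith
      have hxk1R : ∀ i, ‖x (k + 1) i - xs‖ ≤ R := fun i =>
        (hxk1 i).trans ((hsmall (k + 1) (by omega)).trans hrR)
      have hVk : V (k + 1) = fun i => φ i (x k i) := funext (ho.V_succ k)
      refine ⟨hxk1, hD (k + 1) hxk1R fun i => ?_, ?_⟩
      · have h1 : ‖Y (k + 1) i - mean (Y (k + 1))‖ ≤ A + 1 := by
          refine (norm_le_pi_norm (Y (k + 1) - fun _ => mean (Y (k + 1))) i).trans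
            ((hn _).trans (ih3.trans ?_))
          have : ρ ^ k * A ≤ A := mul_le_of_le_one_left hA0.le (pow_le_one₀ hρ.le hρ1.le)
          linarith
        have h2 : ‖mean (Y (k + 1))‖ ≤ 2 + (Φ + L * R) := by
          rw [ho.mean_sub hP, hVk]
          exact (norm_add_le _ _).trans (add_le_add hξ ((norm_mean_le _).trans (hφ _ hxk)))
        have h3 := norm_le_norm_add_norm_sub' (Y (k + 1) i) (mean (Y (k + 1)))
        have := norm_nonneg p
        linarith
      · rw [ho.Y_succ (k + 1), hP.mix_sub_mean]
        refine (hnρ _).trans ?_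
        have h1 : n ((fun i => φ i (x (k + 1) i)) - V (k + 1)) ≤ C * (L * (ε * Bd)) := by
          rw [hVk]
          refine (hnC _).trans (mul_le_mul_of_nonneg_left ?_ hC0.le)
          refine (pi_norm_le_iff_of_nonneg (by positivity)).2 fun i => ?_
          exact (h.φ_lip i _ _ (hxk1R i) (hxk i)).trans (mul_le_mul_of_nonneg_left (ih2 i) hL.le)
        have h2 := map_add_le_add n (Y (k + 1) - fun _ => mean (Y (k + 1)))
          ((fun i => φ i (x (k + 1) i)) - V (k + 1))
        have h3 : n ((fun i => φ i (x (k + 1) i)) - V (k + 1)) ≤ τ * (1 - ρ) :=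
          h1.trans (le_of_eq_of_le (by ring) hετ.le)
        have h4 : 0 ≤ n ((fun i => φ i (x (k + 1) i)) - V (k + 1)) := apply_nonneg _ _
        calc _ ≤ ρ * ((ρ ^ k * A + τ) + n ((fun i => φ i (x (k + 1) i)) - V (k + 1))) := by
              gcongr; linarith
          _ ≤ ρ * (ρ ^ k * A + τ) + 1 * (τ * (1 - ρ)) := by
              rw [mul_add]; gcongr
          _ = ρ ^ (k + 1) * A + τ := by ring
  have hsm : r + (k₀ + 1) * (ε * Bd) ≤ r₁ := by linarith
  obtain ⟨h1, h2, h3⟩ := key k₀ le_rfl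
  have hεB0 : 0 ≤ ε * Bd := by positivity
  refine ⟨fun i => ?_, fun i => ?_, (hn _).trans (by linarith)⟩
  · have := norm_sub_le_norm_sub_add_norm_sub (x (k₀ + 1) i) (x k₀ i) xs
    have := h1 i
    have := h2 i
    linarith
  · have := h1 i
    linarith

end orbit
-- Perturbed equilibria and the limit map.
section orbit
variable {N : ℕ} {X E : Type*} [NormedAddCommGroup X] [NormedSpace ℝ X]
  [NormedAddCommGroup E] [NormedSpace ℝ E]

theorem hasStrictFDerivAt_mean {φ : Fin N → X → E} {φ' : Fin N → X →L[ℝ] E} {xs : X}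
    (hφ : ∀ j, HasStrictFDerivAt (φ j) (φ' j) xs) :
    HasStrictFDerivAt (fun x => mean fun j => φ j x) (mean φ') xs :=
  (HasStrictFDerivAt.fun_sum fun j _ => hφ j).const_smul ((N : ℝ)⁻¹)

theorem contDiffAt_mean {n : WithTop ℕ∞} {φ : Fin N → X → E} {xs : X}
    (hφ : ∀ j, ContDiffAt ℝ n (φ j) xs) : ContDiffAt ℝ n (fun x => mean fun j => φ j x) xs :=
  (ContDiffAt.sum fun j _ => hφ j).const_smul ((N : ℝ)⁻¹)

/-- The strict derivative of the reduced update map in the perturbation and the estimate. -/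
theorem hasStrictFDerivAt_reduced {φ : Fin N → X → E} {φ' : Fin N → X →L[ℝ] E} {F : E → X}
    {F' : E →L[ℝ] X} {xs : X} (hφ : ∀ j, HasStrictFDerivAt (φ j) (φ' j) xs)
    (hF : HasStrictFDerivAt F F' (mean fun j => φ j xs)) :
    HasStrictFDerivAt (fun q : E × X => F (q.1 + mean fun j => φ j q.2))
      (F' ∘L (.fst ℝ E X + mean φ' ∘L .snd ℝ E X)) (0, xs) := by
  have h1 : HasStrictFDerivAt (fun q : E × X => q.1 + mean fun j => φ j q.2)
      (.fst ℝ E X + mean φ' ∘L .snd ℝ E X) (0, xs) :=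
    hasStrictFDerivAt_fst.add
      ((hasStrictFDerivAt_mean hφ).comp (0, xs) (f := Prod.snd) hasStrictFDerivAt_snd)
  have h2 : HasStrictFDerivAt F F' ((0 : E) + mean fun j => φ j xs) := by rwa [zero_add]
  exact h2.comp ((0 : E), xs) h1

/-- Strict differentiability of the reduced map jointly in (ξ, x) supplies the two-point estimate
`lin` for any prescribed δ, uniformly in ξ; mere differentiability at (0, xs) would not. -/
theorem exists_localData {φ : Fin N → X → E} {φ' : Fin N → X →L[ℝ] E} {F : E → X}
    {F' : E →L[ℝ] X} {xs : X} (hφ : ∀ j, HasStrictFDerivAt (φ j) (φ' j) xs)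
    (hF : HasStrictFDerivAt F F' (mean fun j => φ j xs)) {δ : ℝ} (hδ : 0 < δ) :
    ∃ L R, LocalData φ F (F' ∘L mean φ') xs (mean fun j => φ j xs) L R δ := by
  choose K s hs hK using fun j => (hφ j).exists_lipschitzOnWith
  obtain ⟨KF, t, ht, hKF⟩ := hF.exists_lipschitzOnWith
  obtain ⟨w, hw, hlin⟩ := (hasStrictFDerivAt_reduced hφ hF).approximates_deriv_on_nhds
    (c := ⟨δ, hδ.le⟩) (Or.inr hδ)
  have hs' : (⋂ j, s j) ∈ 𝓝 xs := by simpa using hs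
  obtain ⟨R₁, hR₁, hb₁⟩ := Metric.nhds_basis_closedBall.mem_iff.1 hs'
  obtain ⟨R₂, hR₂, hb₂⟩ := Metric.nhds_basis_closedBall.mem_iff.1 ht
  obtain ⟨R₃, hR₃, hb₃⟩ := Metric.nhds_basis_closedBall.mem_iff.1 hw
  obtain ⟨L, hL⟩ : ∃ L : ℝ, L = ∑ j, (K j : ℝ) + KF + 1 := ⟨_, rfl⟩
  have hKs : ∀ j, (K j : ℝ) ≤ ∑ j, (K j : ℝ) := fun j =>
    Finset.single_le_sum (f := fun j => (K j : ℝ)) (fun j _ => (K j).2) (Finset.mem_univ j)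
  have hKs0 : 0 ≤ ∑ j, (K j : ℝ) := Finset.sum_nonneg fun j _ => (K j).2
  have hKF0 : (0 : ℝ) ≤ KF := KF.2
  refine ⟨L, min (min R₁ R₂) R₃, by linarith, by positivity, ?_, ?_, ?_⟩
  · intro j x x' hx hx'
    have hmem : ∀ x, ‖x - xs‖ ≤ min (min R₁ R₂) R₃ → x ∈ s j := fun x hx =>
      Set.mem_iInter.1 (hb₁ (mem_closedBall_iff_norm.2
        (hx.trans ((min_le_left _ _).trans (min_le_left _ _))))) j
    refine ((hK j).norm_sub_le (hmem x hx) (hmem x' hx')).trans ?_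
    gcongr
    have := hKs j
    linarith
  · intro y y' hy hy'
    have hmem : ∀ y, ‖y - mean fun j => φ j xs‖ ≤ min (min R₁ R₂) R₃ → y ∈ t := fun x hx =>
      hb₂ (mem_closedBall_iff_norm.2 (hx.trans ((min_le_left _ _).trans (min_le_right _ _))))
    refine (hKF.norm_sub_le (hmem y hy) (hmem y' hy')).trans ?_
    gcongr
    linarith
  · intro ξ x x' hξ hx hx'
    have hmem : ∀ x, ‖x - xs‖ ≤ min (min R₁ R₂) R₃ → (ξ, x) ∈ w := fun x hx =>
      hb₃ (mem_closedBall_iff_norm.2 (by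
        rw [Prod.mk_sub_mk, sub_zero, Prod.norm_mk]
        exact max_le (hξ.trans (min_le_right _ _)) (hx.trans (min_le_right _ _))))
    have h3 : _ ≤ δ * ‖(ξ, x) - (ξ, x')‖ := hlin (ξ, x) (hmem x hx) (ξ, x') (hmem x' hx')
    simpa using h3

variable [FiniteDimensional ℝ X] [FiniteDimensional ℝ E]

/-- A `C¹` branch of perturbed equilibria, extended to all perturbations. -/
theorem exists_equilibrium_map {φ : Fin N → X → E} {φ' : Fin N → X →L[ℝ] E} {F : E → X}
    {F' : E →L[ℝ] X} {xs : X} (hφ : ∀ j, ContDiffAt ℝ 1 (φ j) xs)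
    (hφ' : ∀ j, HasFDerivAt (φ j) (φ' j) xs)
    (hF : ContDiffAt ℝ 1 F (mean fun j => φ j xs))
    (hF' : HasFDerivAt F F' (mean fun j => φ j xs)) (hfix : F (mean fun j => φ j xs) = xs)
    (hinj : ∀ d, F' (mean φ' d) = d → d = 0) :
    ∃ (Ψ : E → X) (a r : ℝ), ContDiff ℝ 1 Ψ ∧ 0 < a ∧ 0 < r ∧ (∀ ξ, ‖Ψ ξ - xs‖ ≤ a * ‖ξ‖) ∧
      ∀ ξ, ‖ξ‖ ≤ r → F (ξ + mean fun j => φ j (Ψ ξ)) = Ψ ξ := by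
  have : CompleteSpace X := FiniteDimensional.complete ℝ X
  have : CompleteSpace E := FiniteDimensional.complete ℝ E
  have hsφ := fun j => (hφ j).hasStrictFDerivAt' (hφ' j) one_ne_zero
  have hsF := hF.hasStrictFDerivAt' hF' one_ne_zero
  let Θ : E × X → X := fun q => F (q.1 + mean fun j => φ j q.2) - q.2
  have hΘ : ContDiffAt ℝ 1 Θ (0, xs) := by
    have h1 : ContDiffAt ℝ 1 (fun q : E × X => q.1 + mean fun j => φ j q.2) (0, xs) :=
      contDiffAt_fst.add ((contDiffAt_mean hφ).comp ((0 : E), xs) (f := Prod.snd) contDiffAt_snd)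
    have h2 : ContDiffAt ℝ 1 F ((0 : E) + mean fun j => φ j xs) := by rwa [zero_add]
    exact (h2.comp ((0 : E), xs) h1).sub contDiffAt_snd
  have hΘ' : fderiv ℝ Θ (0, xs)
      = F' ∘L (.fst ℝ E X + mean φ' ∘L .snd ℝ E X) - .snd ℝ E X :=
    ((hasStrictFDerivAt_reduced hsφ hsF).hasFDerivAt.sub hasFDerivAt_snd).fderiv
  have hinv : (fderiv ℝ Θ (0, xs) ∘L .inr ℝ E X).IsInvertible := by
    have happ : ∀ d, (fderiv ℝ Θ (0, xs) ∘L .inr ℝ E X) d = F' (mean φ' d) - d := fun d => by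
      rw [hΘ']; simp
    -- In finite dimension injectivity suffices, and a kernel vector would be fixed by the
    -- linearized map.
    have hi : Function.Injective ((fderiv ℝ Θ (0, xs) ∘L .inr ℝ E X : X →L[ℝ] X) : X →ₗ[ℝ] X) := by
      refine (injective_iff_map_eq_zero _).2 fun d hd => hinj d ?_
      have : (fderiv ℝ Θ (0, xs) ∘L .inr ℝ E X) d = 0 := hd
      rw [happ] at this
      exact sub_eq_zero.1 this
    refine ⟨(LinearEquiv.ofInjectiveEndo _ hi).toContinuousLinearEquiv, ?_⟩
    ext d
    rfl
  let ψ : E → X := hΘ.implicitFunction one_ne_zero hinv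
  have hψ0 : ψ 0 = xs := hΘ.implicitFunction_apply_self one_ne_zero hinv
  have hψ : ContDiffAt ℝ 1 ψ 0 := hΘ.contDiffAt_implicitFunction one_ne_zero hinv
  have hΘ0 : Θ (0, xs) = 0 := by simp [Θ, hfix]
  have hψfix : ∀ᶠ ξ in 𝓝 (0 : E), F (ξ + mean fun j => φ j (ψ ξ)) = ψ ξ :=
    (hΘ.eventually_apply_implicitFunction one_ne_zero hinv).mono fun ξ hξ =>
      sub_eq_zero.1 (hξ.trans hΘ0)
  obtain ⟨K, s, hs, hK⟩ := (hψ.hasStrictFDerivAt one_ne_zero).exists_lipschitzOnWith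
  obtain ⟨r, hr, hb⟩ := Metric.nhds_basis_closedBall.mem_iff.1
    ((hψfix.and (hψ.eventually (by simp))).and hs)
  -- The implicit function is C¹ and Lipschitz on the ball of radius r. The cutoff leaves it
  -- unchanged on half the radius and makes Ψ constantly xs outside, so the linear bound becomes
  -- global.
  let b : ContDiffBump (0 : E) := ⟨r / 2, r, by positivity, by linarith⟩
  refine ⟨fun ξ => xs + b ξ • (ψ ξ - xs), K + 1, r / 2, ?_, by positivity, by positivity, ?_, ?_⟩
  · refine contDiff_iff_contDiffAt.2 fun ξ => ?_
    by_cases hξ : ξ ∈ Metric.closedBall (0 : E) r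
    · exact contDiffAt_const.add (b.contDiffAt.smul ((hb hξ).1.2.sub contDiffAt_const))
    · have hξ' : ξ ∉ tsupport b := by rw [b.tsupport_eq]; exact hξ
      have h0 : (fun ξ => xs + b ξ • (ψ ξ - xs)) =ᶠ[𝓝 ξ] fun _ => xs := by
        filter_upwards [notMem_tsupport_iff_eventuallyEq.1 hξ'] with ζ hζ
        simp [hζ]
      exact contDiffAt_const.congr_of_eventuallyEq h0
  · intro ξ
    rw [add_sub_cancel_left, norm_smul, Real.norm_of_nonneg b.nonneg]
    by_cases hξ : ξ ∈ Metric.closedBall (0 : E) r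
    · have h1 := hK.norm_sub_le (hb hξ).2 (mem_of_mem_nhds hs)
      rw [hψ0, sub_zero] at h1
      calc b ξ * ‖ψ ξ - xs‖ ≤ 1 * (K * ‖ξ‖) :=
            mul_le_mul b.le_one h1 (norm_nonneg _) zero_le_one
        _ ≤ (K + 1) * ‖ξ‖ := by have := norm_nonneg ξ; linarith
    · have : b ξ = 0 := b.zero_of_le_dist (not_le.1 hξ).le
      rw [this, zero_mul]
      positivity
  · intro ξ hξ
    have h1 : b ξ = 1 := b.one_of_mem_closedBall (by simpa using hξ)
    have h2 : ξ ∈ Metric.closedBall (0 : E) r := by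
      rw [mem_closedBall_zero_iff]; linarith
    simp only [h1, one_smul, add_sub_cancel]
    exact (hb h2).1.1

/-- Convergence of the abstract recursion to the perturbed equilibrium. -/
theorem exists_limit_map {G : SimpleGraph (Fin N)} {P : Matrix (Fin N) (Fin N) ℝ}
    (hP : IsConsensusMatrix G P) {φ : Fin N → X → E} {φ' : Fin N → X →L[ℝ] E} {F : E → X}
    {F' : E →L[ℝ] X} {xs : X} (hφ : ∀ j, ContDiffAt ℝ 1 (φ j) xs)
    (hφ' : ∀ j, HasFDerivAt (φ j) (φ' j) xs)
    (hF : ContDiffAt ℝ 1 F (mean fun j => φ j xs))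
    (hF' : HasFDerivAt F F' (mean fun j => φ j xs)) (hfix : F (mean fun j => φ j xs) = xs)
    {CF : ℝ} (hCF : 0 ≤ CF) (hgrowth : ∀ y, ‖F y‖ ≤ CF * ‖y‖)
    {S : X →L[ℝ] X} {CS : ℝ} (hCS : 0 ≤ CS) (hS : ∀ d, ‖d‖ ≤ CS * ‖S d‖) {μ ε₁ : ℝ}
    (hμ : 0 < μ) (hμ1 : μ ≤ 1) (hε₁ : 0 < ε₁)
    (hB : ∀ ε, 0 < ε → ε < ε₁ → ∀ d,
      ‖S ((1 - ε) • d + ε • F' (mean φ' d))‖ ≤ (1 - ε * μ) * ‖S d‖) :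
    ∃ (a r εbar : ℝ) (Ψ : E → X), 0 < a ∧ 0 < r ∧ 0 < εbar ∧ ContDiff ℝ 1 Ψ ∧
      (∀ ξ, ‖Ψ ξ - xs‖ ≤ a * ‖ξ‖) ∧
      ∀ ε, 0 < ε → ε < εbar → ∀ x Y V, IsOrbit P φ F ε x Y V → (∀ i, ‖x 0 i - xs‖ ≤ r) →
        (∀ i, ‖Y 0 i - mean fun j => φ j xs‖ ≤ r) → (∀ i, ‖V 0 i - mean fun j => φ j xs‖ ≤ r) →
        ∀ i, Tendsto (fun k => x k i) atTop (𝓝 (Ψ (mean (Y 0 - V 0)))) := by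
  -- The Euler step leaves a fixed vector d of the linearization unchanged, yet shrinks ‖S d‖ unless
  -- S d = 0; and S is bounded below.
  have hinj : ∀ d, F' (mean φ' d) = d → d = 0 := by
    intro d hd
    have h1 := hB (ε₁ / 2) (by positivity) (by linarith) d
    rw [hd, ← add_smul, sub_add_cancel, one_smul] at h1
    have h2 : 0 < ε₁ / 2 * μ := by positivity
    have h3 : ‖S d‖ = 0 := by
      have h4 := norm_nonneg (S d)
      by_contra hne
      have := mul_pos h2 (lt_of_le_of_ne h4 (Ne.symm hne))
      linarith
    have h4 := hS d
    rw [h3, mul_zero] at h4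
    exact norm_le_zero_iff.1 h4
  obtain ⟨Ψ, a, rΨ, hΨ, ha, hrΨ, hΨa, hΨfix⟩ :=
    exists_equilibrium_map hφ hφ' hF hF' hfix hinj
  have hsφ := fun j => (hφ j).hasStrictFDerivAt' (hφ' j) one_ne_zero
  have hsF := hF.hasStrictFDerivAt' hF' one_ne_zero
  obtain ⟨δ, hδ0, hδ⟩ : ∃ δ, 0 < δ ∧ ‖S‖ * δ * CS ≤ μ / 2 := by
    have hpos : 0 < ‖S‖ * CS + 1 := by positivity
    refine ⟨μ / 2 / (‖S‖ * CS + 1), by positivity, ?_⟩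
    calc ‖S‖ * (μ / 2 / (‖S‖ * CS + 1)) * CS = μ / 2 * (‖S‖ * CS / (‖S‖ * CS + 1)) := by ring
      _ ≤ μ / 2 * 1 := by
        gcongr
        exact (div_le_one hpos).2 (by linarith)
      _ = μ / 2 := mul_one _
  obtain ⟨L, R, hloc⟩ := exists_localData hsφ hsF hδ0
  obtain ⟨r₁, ε₂, hr₁, hε₂, hconv⟩ := hloc.local_convergence hP rfl hCS hS hμ hμ1 hε₁ hB hδ
  obtain ⟨r₂, hr₂, htrans⟩ := hloc.transient hP hCF hgrowth hr₁
  -- The perturbation has norm at most 2r, hence the halved radius rΨ and the factor 2a.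
  obtain ⟨r, hr⟩ : ∃ r, r = min (min r₂ (rΨ / 2)) (min (r₁ / 2) (r₁ / (2 * a))) := ⟨_, rfl⟩
  have hr0 : 0 < r := by rw [hr]; positivity
  have hrr₂ : r ≤ r₂ := hr ▸ (min_le_left _ _).trans (min_le_left _ _)
  have hrΨ' : r ≤ rΨ / 2 := hr ▸ (min_le_left _ _).trans (min_le_right _ _)
  have hrr₁ : r ≤ r₁ / 2 := hr ▸ (min_le_right _ _).trans (min_le_left _ _)
  have hra : r * (2 * a) ≤ r₁ :=
    (le_div_iff₀ (by positivity)).1 (hr ▸ (min_le_right _ _).trans (min_le_right _ _))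
  obtain ⟨ε₃, hε₃, k₀, htr⟩ := htrans r hr0 hrr₂
  refine ⟨a, r, min ε₂ ε₃, Ψ, ha, hr0, by positivity, hΨ, hΨa, ?_⟩
  intro ε hε hεlt x Y V ho hx hY hV
  have hξ : ‖mean (Y 0 - V 0)‖ ≤ 2 * r := by
    refine (norm_mean_le _).trans ((pi_norm_le_iff_of_nonneg (by positivity)).2 fun i => ?_)
    have := norm_sub_le_norm_sub_add_norm_sub (Y 0 i) (mean fun j => φ j xs) (V 0 i)
    rw [norm_sub_rev (mean fun j => φ j xs)] at this
    have := hY i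
    have := hV i
    rw [Pi.sub_apply]
    linarith
  obtain ⟨h1, h2, h3⟩ := htr ε hε (hεlt.trans_le (min_le_right _ _)) x Y V ho hx hY hV
  refine hconv ε hε (hεlt.trans_le (min_le_left _ _)) x Y V ho _ (by linarith) ?_
    (hΨfix _ (by linarith)) k₀ h1 h2 h3
  refine (hΨa _).trans ((mul_le_mul_of_nonneg_left hξ ha.le).trans ?_)
  linarith

end orbit

/-! ### Euler contraction, matrix action and the thresholded search map. -/

/-- An explicit Euler step along a field that is strongly monotone after a change of variables is
a contraction. -/
theorem exists_euler_contraction {X : Type*} [NormedAddCommGroup X] [InnerProductSpace ℝ X]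
    (S A : X →L[ℝ] X) {c : ℝ} (hc : 0 < c) (hSA : ∀ d, c * ‖d‖ ^ 2 ≤ inner ℝ (S d) (S (A d))) :
    ∃ μ ε₁ : ℝ, 0 < μ ∧ μ ≤ 1 ∧ 0 < ε₁ ∧ ∀ ε, 0 < ε → ε < ε₁ → ∀ d,
      ‖S (d - ε • A d)‖ ≤ (1 - ε * μ) * ‖S d‖ := by
  obtain ⟨κ, hκ⟩ : ∃ κ, κ = ‖S ∘L A‖ ^ 2 + 1 := ⟨_, rfl⟩
  have hκ0 : 0 < κ := by rw [hκ]; positivity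
  obtain ⟨μ, hμ⟩ : ∃ μ, μ = min 1 (c / (2 * (‖S‖ ^ 2 + 1))) := ⟨_, rfl⟩
  have hμ0 : 0 < μ := by rw [hμ]; positivity
  have hμ1 : μ ≤ 1 := hμ ▸ min_le_left _ _
  have hμc : μ * (2 * (‖S‖ ^ 2 + 1)) ≤ c :=
    (le_div_iff₀ (by positivity)).1 (hμ ▸ min_le_right _ _)
  refine ⟨μ, min 1 (c / κ), hμ0, hμ1, by positivity, fun ε hε hεlt d => ?_⟩
  have hε1 : ε < 1 := hεlt.trans_le (min_le_left _ _)
  have hεκ : ε * κ < c := (lt_div_iff₀ hκ0).1 (hεlt.trans_le (min_le_right _ _))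
  have hεμ : 0 ≤ 1 - ε * μ := by nlinarith
  refine abs_le_of_sq_le_sq' ?_ (by positivity) |>.2
  -- Of the gain 2εc‖d‖² from monotonicity, half absorbs the quadratic term, since εκ < c; the rest
  -- is at least 2εμ‖S d‖², and 1 - 2εμ ≤ (1 - εμ)².
  have h1 : ‖S (d - ε • A d)‖ ^ 2
      = ‖S d‖ ^ 2 - 2 * ε * inner ℝ (S d) (S (A d)) + ε ^ 2 * ‖S (A d)‖ ^ 2 := by
    rw [map_sub, map_smul, norm_sub_sq_real, inner_smul_right, norm_smul, mul_pow,
      Real.norm_eq_abs, sq_abs]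
    ring
  have h2 : ‖S (A d)‖ ^ 2 ≤ κ * ‖d‖ ^ 2 := by
    have h3 : ‖S (A d)‖ ≤ ‖S ∘L A‖ * ‖d‖ := (S ∘L A).le_opNorm d
    calc ‖S (A d)‖ ^ 2 ≤ (‖S ∘L A‖ * ‖d‖) ^ 2 := by gcongr
      _ = ‖S ∘L A‖ ^ 2 * ‖d‖ ^ 2 := by ring
      _ ≤ κ * ‖d‖ ^ 2 := by gcongr; rw [hκ]; linarith
  have h4 : ‖S d‖ ^ 2 ≤ (‖S‖ ^ 2 + 1) * ‖d‖ ^ 2 := by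
    calc ‖S d‖ ^ 2 ≤ (‖S‖ * ‖d‖) ^ 2 := by gcongr; exact S.le_opNorm d
      _ = ‖S‖ ^ 2 * ‖d‖ ^ 2 := by ring
      _ ≤ (‖S‖ ^ 2 + 1) * ‖d‖ ^ 2 := by gcongr; linarith
  have h5 : 2 * μ * ‖S d‖ ^ 2 ≤ c * ‖d‖ ^ 2 := by
    calc 2 * μ * ‖S d‖ ^ 2 ≤ 2 * μ * ((‖S‖ ^ 2 + 1) * ‖d‖ ^ 2) := by gcongr
      _ = μ * (2 * (‖S‖ ^ 2 + 1)) * ‖d‖ ^ 2 := by ring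
      _ ≤ c * ‖d‖ ^ 2 := by gcongr
  have h6 : ε ^ 2 * ‖S (A d)‖ ^ 2 ≤ ε * (c * ‖d‖ ^ 2) := by
    calc ε ^ 2 * ‖S (A d)‖ ^ 2 ≤ ε ^ 2 * (κ * ‖d‖ ^ 2) := by gcongr
      _ = ε * (ε * κ * ‖d‖ ^ 2) := by ring
      _ ≤ ε * (c * ‖d‖ ^ 2) := by gcongr
  have h7 := mul_le_mul_of_nonneg_left (hSA d) hε.le
  have h8 := mul_le_mul_of_nonneg_left h5 hε.le
  have h9 : 0 ≤ (ε * μ) ^ 2 * ‖S d‖ ^ 2 := by positivity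
  rw [h1, mul_pow]
  linarith

/-- The action of matrices on Euclidean space as a continuous bilinear map. -/
noncomputable def actL (n : ℕ) : Mat n →L[ℝ] Vec n →L[ℝ] Vec n :=
  LinearMap.toContinuousLinearMap
    { toFun := fun A => Matrix.toEuclideanCLM (𝕜 := ℝ) A
      map_add' := map_add _
      map_smul' := map_smul _ }

theorem actL_apply {n : ℕ} (A : Mat n) (x : Vec n) : actL n A x = act A x := rfl

theorem actL_mul {n : ℕ} (A B : Mat n) : actL n (A * B) = actL n A * actL n B :=
  map_mul (Matrix.toEuclideanCLM (𝕜 := ℝ) (n := Fin n)) A B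

theorem actL_one {n : ℕ} : actL n 1 = 1 :=
  map_one (Matrix.toEuclideanCLM (𝕜 := ℝ) (n := Fin n))

theorem act_mul {n : ℕ} (A B : Mat n) (x : Vec n) : act (A * B) x = act A (act B x) := by
  rw [← actL_apply, actL_mul]; rfl

theorem act_one {n : ℕ} (x : Vec n) : act (1 : Mat n) x = x := by
  rw [← actL_apply, actL_one]; rfl

theorem inner_act {n : ℕ} (A : Mat n) (x y : Vec n) :
    inner ℝ x (act A y) = x.ofLp ⬝ᵥ A.mulVec y.ofLp :=
  Matrix.inner_toEuclideanCLM A x y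

theorem geScalar_iff_inner {n : ℕ} {Z : Mat n} {a : ℝ} :
    GeScalar Z a ↔ ∀ u : Vec n, a * ‖u‖ ^ 2 ≤ inner ℝ u (act Z u) := by
  have hnorm : ∀ u : Vec n, ‖u‖ ^ 2 = u.ofLp ⬝ᵥ u.ofLp := fun u => by
    rw [EuclideanSpace.real_norm_sq_eq]
    exact Finset.sum_congr rfl fun i _ => pow_two _
  constructor
  · intro h u
    rw [hnorm, inner_act]
    exact h u.ofLp
  · intro h u
    have := h (WithLp.toLp 2 u)
    rwa [hnorm, inner_act] at this

theorem GeScalar.isUnit_det {n : ℕ} {Z : Mat n} {a : ℝ} (ha : 0 < a) (h : GeScalar Z a) :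
    IsUnit Z.det := by
  rw [← Matrix.isUnit_iff_isUnit_det, ← Matrix.mulVec_injective_iff_isUnit]
  refine (injective_iff_map_eq_zero Z.mulVecLin).2 fun u hu => ?_
  have h1 := geScalar_iff_inner.1 h (WithLp.toLp 2 u)
  rw [inner_act, show Z.mulVec (WithLp.toLp 2 u).ofLp = 0 from hu, dotProduct_zero] at h1
  have h2 : ‖WithLp.toLp 2 u‖ ^ 2 ≤ 0 := by
    by_contra h3
    have := mul_pos ha (not_le.1 h3)
    linarith
  have h3 : WithLp.toLp 2 u = 0 := by
    rw [← norm_eq_zero]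
    exact pow_eq_zero_iff two_ne_zero |>.1 (le_antisymm h2 (sq_nonneg _))
  simpa using h3

theorem GeScalar.act_act_inv {n : ℕ} {Z : Mat n} {a : ℝ} (ha : 0 < a) (h : GeScalar Z a)
    (y : Vec n) : act Z (act Z⁻¹ y) = y := by
  rw [← act_mul, Matrix.mul_nonsing_inv _ (h.isUnit_det ha), act_one]

theorem GeScalar.act_inv_act {n : ℕ} {Z : Mat n} {a : ℝ} (ha : 0 < a) (h : GeScalar Z a)
    (y : Vec n) : act Z⁻¹ (act Z y) = y := by
  rw [← act_mul, Matrix.nonsing_inv_mul _ (h.isUnit_det ha), act_one]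

/-- Test the form at u = Z⁻¹ y and apply Cauchy–Schwarz; no symmetry of Z is needed. -/
theorem GeScalar.norm_act_inv_le {n : ℕ} {Z : Mat n} {a : ℝ} (ha : 0 < a) (h : GeScalar Z a)
    (y : Vec n) : ‖act Z⁻¹ y‖ ≤ a⁻¹ * ‖y‖ := by
  set u := act Z⁻¹ y with hu
  have h1 := geScalar_iff_inner.1 h u
  rw [h.act_act_inv ha] at h1
  have h2 := h1.trans (real_inner_le_norm u y)
  rw [le_inv_mul_iff₀ ha]
  rcases (norm_nonneg u).eq_or_lt with h0 | h0
  · rw [← h0, mul_zero]; exact norm_nonneg y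
  · refine le_of_mul_le_mul_left ?_ h0
    linarith

theorem geScalar_clip {n : ℕ} (c : ℝ) (Z : Mat n) : GeScalar (clip c Z) (c / 2) := by
  unfold clip
  split_ifs with h
  · exact h
  · intro u
    simp [Matrix.smul_mulVec]

/-- The search map `(y, z) ↦ [z]_c⁻¹ y`. -/
noncomputable def searchMap {n : ℕ} (c : ℝ) (q : Vec n × Mat n) : Vec n := act (clip c q.2)⁻¹ q.1

theorem norm_searchMap_le {n : ℕ} {c : ℝ} (hc : 0 < c) (q : Vec n × Mat n) :
    ‖searchMap c q‖ ≤ (c / 2)⁻¹ * ‖q‖ := by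
  refine ((geScalar_clip c q.2).norm_act_inv_le (half_pos hc) q.1).trans ?_
  gcongr
  exact norm_fst_le q

/-- The gap between c and c/2 absorbs perturbations of operator norm below c/2. The threshold is
thus inactive near the reference point, where the search map is smooth. -/
theorem GeScalar.eventually {n : ℕ} {Z : Mat n} {c : ℝ} (hc : 0 < c) (h : GeScalar Z c) :
    ∀ᶠ z in 𝓝 Z, GeScalar z (c / 2) := by
  have hcont : Tendsto (fun z => ‖actL n (z - Z)‖) (𝓝 Z) (𝓝 ‖actL n (Z - Z)‖) :=
    ((actL n).continuous.comp (continuous_id.sub continuous_const)).norm.tendsto Z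
  rw [sub_self, map_zero, norm_zero] at hcont
  filter_upwards [hcont.eventually (gt_mem_nhds (half_pos hc))] with z hz
  refine geScalar_iff_inner.2 fun u => ?_
  have h1 := geScalar_iff_inner.1 h u
  have h2 : act z u = act Z u + actL n (z - Z) u := by
    rw [map_sub]; simp [actL_apply]
  have h3 : |inner ℝ u (actL n (z - Z) u)| ≤ c / 2 * ‖u‖ ^ 2 := by
    calc _ ≤ ‖u‖ * ‖actL n (z - Z) u‖ := abs_real_inner_le_norm _ _
      _ ≤ ‖u‖ * (c / 2 * ‖u‖) := by
        gcongr
        exact ((actL n (z - Z)).le_opNorm u).trans (by gcongr)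
      _ = c / 2 * ‖u‖ ^ 2 := by ring
  rw [h2, inner_add_right]
  have := (abs_le.1 h3).1
  linarith

theorem GeScalar.ringInverse_actL {n : ℕ} {Z : Mat n} {a : ℝ} (ha : 0 < a) (h : GeScalar Z a) :
    ∃ U : (Vec n →L[ℝ] Vec n)ˣ, (U : Vec n →L[ℝ] Vec n) = actL n Z ∧
      ((U⁻¹ : (Vec n →L[ℝ] Vec n)ˣ) : Vec n →L[ℝ] Vec n) = actL n Z⁻¹ :=
  ⟨⟨actL n Z, actL n Z⁻¹, by rw [← actL_mul, Matrix.mul_nonsing_inv _ (h.isUnit_det ha), actL_one],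
    by rw [← actL_mul, Matrix.nonsing_inv_mul _ (h.isUnit_det ha), actL_one]⟩, rfl, rfl⟩

theorem searchMap_eventuallyEq {n : ℕ} {c : ℝ} (hc : 0 < c) {q : Vec n × Mat n}
    (h : GeScalar q.2 c) :
    searchMap c =ᶠ[𝓝 q] fun q => Ring.inverse (actL n q.2) q.1 := by
  filter_upwards [continuous_snd.continuousAt.eventually (h.eventually hc)] with p hp
  obtain ⟨U, hU, hU'⟩ := hp.ringInverse_actL (half_pos hc)
  rw [← hU, Ring.inverse_unit, hU', searchMap, clip, if_pos hp, actL_apply]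

theorem searchMap_act {n : ℕ} {c : ℝ} (hc : 0 < c) {Z : Mat n} (h : GeScalar Z c) (x : Vec n) :
    searchMap c (act Z x, Z) = x := by
  rw [(searchMap_eventuallyEq hc (q := (act Z x, Z)) h).eq_of_nhds]
  obtain ⟨U, hU, hU'⟩ := h.ringInverse_actL hc
  rw [← hU, Ring.inverse_unit, hU']
  exact h.act_inv_act hc x

theorem contDiffAt_searchMap {n : ℕ} {c : ℝ} (hc : 0 < c) {q : Vec n × Mat n}
    (h : GeScalar q.2 c) : ContDiffAt ℝ 1 (searchMap c) q := by
  refine ContDiffAt.congr_of_eventuallyEq ?_ (searchMap_eventuallyEq hc h)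
  obtain ⟨U, hU, -⟩ := h.ringInverse_actL hc
  have h1 : ContDiffAt ℝ 1 Ring.inverse (actL n q.2) := hU ▸ contDiffAt_ringInverse ℝ U
  have h2 : ContDiffAt ℝ 1 (fun q : Vec n × Mat n => actL n q.2) q :=
    ((actL n).contDiff.comp contDiff_snd).contDiffAt
  exact (h1.comp q h2).clm_apply contDiffAt_fst

/-- The derivative of the search map at `(Z x, Z)`. -/
noncomputable def searchDeriv {n : ℕ} (Z : Mat n) (x : Vec n) : Vec n × Mat n →L[ℝ] Vec n :=
  actL n Z⁻¹ ∘L (.fst ℝ (Vec n) (Mat n) - (actL n).flip x ∘L .snd ℝ (Vec n) (Mat n))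

theorem searchDeriv_apply {n : ℕ} (Z : Mat n) (x : Vec n) (q : Vec n × Mat n) :
    searchDeriv Z x q = act Z⁻¹ (q.1 - act q.2 x) := rfl

theorem hasFDerivAt_searchMap {n : ℕ} {c : ℝ} (hc : 0 < c) {x : Vec n} {Z : Mat n}
    (h : GeScalar Z c) : HasFDerivAt (searchMap c) (searchDeriv Z x) (act Z x, Z) := by
  refine HasFDerivAt.congr_of_eventuallyEq ?_ (searchMap_eventuallyEq hc h)
  obtain ⟨U, hU, hU'⟩ := h.ringInverse_actL hc
  have h1 := hasFDerivAt_ringInverse (𝕜 := ℝ) U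
  rw [hU, hU'] at h1
  have h2 : HasFDerivAt (fun q : Vec n × Mat n => actL n q.2)
      (actL n ∘L .snd ℝ (Vec n) (Mat n)) (act Z x, Z) :=
    (actL n).hasFDerivAt.comp (act Z x, Z) hasFDerivAt_snd
  have h3 := (HasFDerivAt.comp (act Z x, Z) (f := fun q : Vec n × Mat n => actL n q.2)
    h1 h2).clm_apply (hasFDerivAt_fst (𝕜 := ℝ) (p := (act Z x, Z)))
  refine h3.congr_fderiv ?_
  refine ContinuousLinearMap.ext fun q => ?_
  have h4 : Ring.inverse (actL n Z) = actL n Z⁻¹ := by rw [← hU, Ring.inverse_unit, hU']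
  have h5 : actL n Z⁻¹ (act Z x) = x := h.act_inv_act hc x
  -- Differentiating the inverse gives -Z⁻¹ q₂ Z⁻¹ applied to Z x, which collapses to -Z⁻¹ q₂ x.
  change Ring.inverse (actL n Z) q.1 + -(actL n Z⁻¹ (actL n q.2 (actL n Z⁻¹ (act Z x))))
    = actL n Z⁻¹ (q.1 - actL n q.2 x)
  rw [h4, h5, map_sub, sub_eq_add_neg]

/-! ### Regularity and derivatives of the local functions g and h. -/

theorem gradient_apply {n : ℕ} (f : Vec n → ℝ) (x : Vec n) (i : Fin n) :
    gradient f x i = fderiv ℝ f x (EuclideanSpace.single i 1) := by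
  have := InnerProductSpace.toDual_symm_apply (𝕜 := ℝ) (x := EuclideanSpace.single i (1 : ℝ))
    (y := fderiv ℝ f x)
  rw [← this, gradient, EuclideanSpace.inner_single_right]
  simp only [one_mul, conj_trivial]

theorem contDiff_gradient {n : ℕ} {f : Vec n → ℝ} (hf : ContDiff ℝ 3 f) :
    ContDiff ℝ 2 (gradient f) := by
  refine contDiff_euclidean.2 fun i => ?_
  simp_rw [gradient_apply]
  exact (hf.fderiv_right (m := 2) (by norm_num)).clm_apply contDiff_const

/-- The entrywise presentation of a matrix as a continuous linear map. -/
noncomputable def matOfL (n : ℕ) : (Fin n → Fin n → ℝ) →L[ℝ] Mat n :=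
  LinearMap.toContinuousLinearMap (Matrix.ofLinearEquiv ℝ).toLinearMap

theorem contDiff_mat {n : ℕ} {X : Type*} [NormedAddCommGroup X] [NormedSpace ℝ X] {k : WithTop ℕ∞}
    {A : X → Mat n} (h : ∀ i j, ContDiff ℝ k fun x => A x i j) : ContDiff ℝ k A :=
  (matOfL n).contDiff.comp (contDiff_pi.2 fun i => contDiff_pi.2 fun j => h i j)

theorem contDiff_hessian_apply {n : ℕ} {f : Vec n → ℝ} (hf : ContDiff ℝ 3 f) (i j : Fin n) :
    ContDiff ℝ 1 fun x => hessian f x i j := by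
  have h1 : ContDiff ℝ 1 fun x => fderiv ℝ (gradient f) x (EuclideanSpace.single j 1) :=
    ((contDiff_gradient hf).fderiv_right (m := 1) (by norm_num)).clm_apply contDiff_const
  exact contDiff_euclidean.1 h1 i

theorem act_hessian {n : ℕ} (f : Vec n → ℝ) (x d : Vec n) :
    act (hessian f x) d = fderiv ℝ (gradient f) x d := by
  have h : (actL n (hessian f x) : Vec n →ₗ[ℝ] Vec n) = (fderiv ℝ (gradient f) x) := by
    refine (EuclideanSpace.basisFun (Fin n) ℝ).toBasis.ext fun j => ?_
    ext i
    simp [actL_apply, act, hessian]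
  exact LinearMap.congr_fun h d

theorem contDiff_hFun {n : ℕ} (s : Curvature) {f : Vec n → ℝ} (hf : ContDiff ℝ 3 f) :
    ContDiff ℝ 1 (hFun s f) := by
  cases s with
  | newton => exact contDiff_mat fun i j => contDiff_hessian_apply hf i j
  | jacobi =>
    refine contDiff_mat fun i j => ?_
    simp only [hFun, Matrix.diagonal_apply]
    split_ifs
    · exact contDiff_hessian_apply hf i i
    · exact contDiff_const
  | gradient => exact contDiff_const

/-- The pair `(g, h)` of local functions of an agent. -/
noncomputable def localPair {n : ℕ} (s : Curvature) (f : Vec n → ℝ) (x : Vec n) : Vec n × Mat n :=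
  (gFun s f x, hFun s f x)

theorem contDiff_localPair {n : ℕ} (s : Curvature) {f : Vec n → ℝ} (hf : ContDiff ℝ 3 f) :
    ContDiff ℝ 1 (localPair s f) :=
  ((((actL n).contDiff.comp (contDiff_hFun s hf)).clm_apply contDiff_id).sub
    ((contDiff_gradient hf).of_le (by norm_num))).prodMk (contDiff_hFun s hf)

/-- The derivative of the pair `(g, h)`. -/
noncomputable def localDeriv {n : ℕ} (s : Curvature) (f : Vec n → ℝ) (x : Vec n) :
    Vec n →L[ℝ] Vec n × Mat n :=
  ((actL n).flip x ∘L fderiv ℝ (hFun s f) x + actL n (hFun s f x) - actL n (hessian f x)).prod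
    (fderiv ℝ (hFun s f) x)

theorem hasFDerivAt_localPair {n : ℕ} (s : Curvature) {f : Vec n → ℝ} (hf : ContDiff ℝ 3 f)
    (x : Vec n) : HasFDerivAt (localPair s f) (localDeriv s f x) x := by
  have h1 : HasFDerivAt (hFun s f) (fderiv ℝ (hFun s f) x) x :=
    ((contDiff_hFun s hf).differentiable one_ne_zero x).hasFDerivAt
  have h2 : HasFDerivAt (gradient f) (fderiv ℝ (gradient f) x) x :=
    ((contDiff_gradient hf).differentiable two_ne_zero x).hasFDerivAt
  have h3 : fderiv ℝ (gradient f) x = actL n (hessian f x) := by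
    ext1 d; rw [← act_hessian]; rfl
  rw [h3] at h2
  have h4 := (((actL n).hasFDerivAt.comp x h1).clm_apply (hasFDerivAt_id x)).sub h2
  refine HasFDerivAt.prodMk (h4.congr_fderiv ?_) h1
  ext1 d
  simp [add_comm]
  rfl

/-! ### Averages over agents and the linearization at the minimizer. -/

section mean
variable {N n : ℕ}

theorem mean_prod {E E' : Type*} [AddCommGroup E] [Module ℝ E] [AddCommGroup E'] [Module ℝ E']
    (a : Fin N → E) (b : Fin N → E') : (mean fun j => (a j, b j)) = (mean a, mean b) := by
  simp [mean, Prod.ext_iff, Prod.fst_sum, Prod.snd_sum]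

theorem map_mean {E E' : Type*} [AddCommGroup E] [Module ℝ E] [AddCommGroup E'] [Module ℝ E']
    (T : E →ₗ[ℝ] E') (a : Fin N → E) : T (mean a) = mean fun j => T (a j) := by
  simp [mean]

theorem fderiv_mean {X E : Type*} [NormedAddCommGroup X] [NormedSpace ℝ X] [NormedAddCommGroup E]
    [NormedSpace ℝ E] {φ : Fin N → X → E} {k : WithTop ℕ∞} (hk : k ≠ 0)
    (hφ : ∀ j, ContDiff ℝ k (φ j)) (x : X) :
    fderiv ℝ (fun x => mean fun j => φ j x) x = mean fun j => fderiv ℝ (φ j) x :=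
  (hasStrictFDerivAt_mean fun j =>
    (hφ j).contDiffAt.hasStrictFDerivAt hk).hasFDerivAt.fderiv

theorem gradient_globalCost {f : Fin N → Vec n → ℝ} (hf : ∀ i, ContDiff ℝ 3 (f i)) (x : Vec n) :
    gradient (globalCost f) x = mean fun j => gradient (f j) x := by
  ext i
  rw [gradient_apply]
  have h1 : fderiv ℝ (globalCost f) x = mean fun j => fderiv ℝ (f j) x :=
    fderiv_mean three_ne_zero hf x
  rw [h1]
  simp [mean, gradient_apply]

theorem hessian_globalCost {f : Fin N → Vec n → ℝ} (hf : ∀ i, ContDiff ℝ 3 (f i)) (x : Vec n) :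
    hessian (globalCost f) x = mean fun j => hessian (f j) x := by
  ext i j
  have h0 : gradient (globalCost f) = fun x => mean fun j => gradient (f j) x :=
    funext (gradient_globalCost hf)
  have h1 := fderiv_mean (φ := fun j => gradient (f j)) two_ne_zero
    (fun j => contDiff_gradient (hf j)) x
  rw [hessian, Matrix.of_apply, h0, h1]
  simp [mean, hessian, Matrix.sum_apply]

theorem mean_clm_apply {X E : Type*} [NormedAddCommGroup X] [NormedSpace ℝ X]
    [NormedAddCommGroup E] [NormedSpace ℝ E] (T : Fin N → X →L[ℝ] E) (d : X) :
    (mean T) d = mean fun j => T j d := by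
  simp [mean]

theorem mean_act (A : Fin N → Mat n) (d : Vec n) : act (mean A) d = mean fun j => act (A j) d :=
  map_mean ((actL n).flip d : Mat n →ₗ[ℝ] Vec n) A

/-- The mean of the local pairs, when the mean gradient vanishes. -/
theorem mean_localPair {f : Fin N → Vec n → ℝ} (s : Curvature) (x : Vec n)
    (hx : (mean fun j => gradient (f j) x) = 0) :
    (mean fun j => localPair s (f j) x)
      = (act (mean fun j => hFun s (f j) x) x, mean fun j => hFun s (f j) x) := by
  have h1 : (fun j => gFun s (f j) x)
      = (fun j => act (hFun s (f j) x) x) - fun j => gradient (f j) x := rfl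
  unfold localPair
  rw [mean_prod, h1, mean_sub, hx, sub_zero, ← mean_act]

/-- The linearization of the reduced update map at a stationary point. -/
theorem reduced_derivative {f : Fin N → Vec n → ℝ} (hf : ∀ i, ContDiff ℝ 3 (f i)) (s : Curvature)
    (x : Vec n) {c : ℝ} (hc : 0 < c) (hh : GeScalar (mean fun j => hFun s (f j) x) c) (d : Vec n) :
    searchDeriv (mean fun j => hFun s (f j) x) x ((mean fun j => localDeriv s (f j) x) d)
      = d - act (mean fun j => hFun s (f j) x)⁻¹ (act (hessian (globalCost f) x) d) := by
  have h1 : (mean fun j => localDeriv s (f j) x) d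
      = (mean fun j => act (fderiv ℝ (hFun s (f j)) x d) x + act (hFun s (f j) x) d
        - act (hessian (f j) x) d, mean fun j => fderiv ℝ (hFun s (f j)) x d) :=
    (mean_clm_apply _ d).trans (mean_prod _ _)
  have h2 : (mean fun j => act (fderiv ℝ (hFun s (f j)) x d) x + act (hFun s (f j) x) d
        - act (hessian (f j) x) d)
      = act (mean fun j => fderiv ℝ (hFun s (f j)) x d) x
        + act (mean fun j => hFun s (f j) x) d - act (hessian (globalCost f) x) d := by
    rw [hessian_globalCost hf, mean_act, mean_act, mean_act, ← mean_add, ← mean_sub]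
    rfl
  rw [searchDeriv_apply, h1]
  dsimp only
  -- The derivative of h, applied to x, enters once through g and once through the search map, with
  -- opposite signs, so no third derivative of the costs survives.
  rw [h2, add_sub_assoc, add_sub_cancel_left, ← actL_apply _ (_ - _), map_sub, actL_apply,
    actL_apply, hh.act_inv_act hc]

end mean

theorem geScalar_diagonal {n : ℕ} {v : Fin n → ℝ} {c : ℝ} (h : ∀ i, c ≤ v i) :
    GeScalar (Matrix.diagonal v) c := by
  intro u
  simp only [dotProduct, Matrix.mulVec_diagonal, Finset.mul_sum]
  refine Finset.sum_le_sum fun i _ => ?_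
  have := mul_le_mul_of_nonneg_right (h i) (mul_self_nonneg (u i))
  linarith

theorem GeScalar.le_diag {n : ℕ} {Z : Mat n} {c : ℝ} (h : GeScalar Z c) (i : Fin n) :
    c ≤ Z i i := by
  simpa using h (Pi.single i 1)

/-- Each of the three curvature choices is affine in the cost and so commutes with averaging; this
ties the preconditioner to the Hessian of the global cost. -/
theorem mean_hFun {N n : ℕ} [NeZero N] {f : Fin N → Vec n → ℝ} (hf : ∀ i, ContDiff ℝ 3 (f i))
    (s : Curvature) (x : Vec n) :
    (mean fun j => hFun s (f j) x) = hFun s (globalCost f) x := by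
  cases s with
  | newton => exact (hessian_globalCost hf x).symm
  | jacobi =>
    simp only [hFun, hessian_globalCost hf]
    ext i j
    simp only [mean, Matrix.smul_apply, Matrix.sum_apply, Matrix.diagonal_apply]
    split_ifs <;> simp
  | gradient => exact mean_const _

theorem geScalar_hFun {n : ℕ} {f : Vec n → ℝ} {x : Vec n} {c : ℝ} (h : GeScalar (hessian f x) c)
    (s : Curvature) (hs : s = Curvature.gradient → c ≤ 1) : GeScalar (hFun s f x) c := by
  cases s with
  | newton => exact h
  | jacobi => exact geScalar_diagonal h.le_diag
  | gradient =>
    have := geScalar_diagonal (v := fun _ : Fin n => (1 : ℝ)) fun _ => hs rfl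
    rwa [Matrix.diagonal_one] at this

/-- A change of variables in which the preconditioned Hessian is strongly monotone. -/
theorem exists_preconditioner_coordinates {n : ℕ} {f : Vec n → ℝ} {x : Vec n} {c : ℝ} (hc : 0 < c)
    (h : GeScalar (hessian f x) c) (s : Curvature) :
    ∃ (S : Vec n →L[ℝ] Vec n) (CS c' : ℝ), 0 ≤ CS ∧ 0 < c' ∧ (∀ d, ‖d‖ ≤ CS * ‖S d‖) ∧
      ∀ d, c' * ‖d‖ ^ 2 ≤ inner ℝ (S d) (S (act (hFun s f x)⁻¹ (act (hessian f x) d))) := by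
  cases s with
  | newton =>
    refine ⟨.id ℝ _, 1, 1, zero_le_one, one_pos, fun d => by simp, fun d => ?_⟩
    simp only [hFun, h.act_inv_act hc, ContinuousLinearMap.id_apply, real_inner_self_eq_norm_sq,
      one_mul, le_refl]
  | gradient =>
    refine ⟨.id ℝ _, 1, c, zero_le_one, hc, fun d => by simp, fun d => ?_⟩
    simpa only [hFun, inv_one, act_one, ContinuousLinearMap.id_apply] using
      geScalar_iff_inner.1 h d
  | jacobi =>
    have hd : GeScalar (hFun .jacobi f x) c := geScalar_diagonal h.le_diag
    have hpos : ∀ i, 0 ≤ hessian f x i i := fun i => hc.le.trans (h.le_diag i)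
    -- S is the square root of the diagonal h, so ⟨S d, S h⁻¹H d⟩ = ⟨d, H d⟩. In the plain Euclidean
    -- product h⁻¹H need not be monotone.
    let S : Vec n →L[ℝ] Vec n := actL n (Matrix.diagonal fun i => √(hessian f x i i))
    have hS : ∀ d e, inner ℝ (S d) (S e) = inner ℝ d (act (hFun .jacobi f x) e) := fun d e => by
      simp only [S, actL_apply, act, hFun, PiLp.inner_apply, Matrix.mulVec_diagonal]
      refine Finset.sum_congr rfl fun i _ => ?_
      have := Real.mul_self_sqrt (hpos i)
      simp only [RCLike.inner_apply, conj_trivial]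
      linear_combination (e i * d i) * this
    refine ⟨S, (√c)⁻¹, c, by positivity, hc, fun d => ?_, fun d => ?_⟩
    · have h1 := geScalar_iff_inner.1 hd d
      rw [← hS, real_inner_self_eq_norm_sq] at h1
      have h2 := Real.sqrt_le_sqrt h1
      rw [Real.sqrt_mul hc.le, Real.sqrt_sq (norm_nonneg _), Real.sqrt_sq (norm_nonneg _)] at h2
      rwa [le_inv_mul_iff₀ (Real.sqrt_pos.2 hc)]
    · rw [hS, hd.act_act_inv hc]
      exact geScalar_iff_inner.1 h d

theorem isOrbit_run {N n : ℕ} (s : Curvature) (f : Fin N → Vec n → ℝ)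
    (P : Matrix (Fin N) (Fin N) ℝ) (c ε : ℝ) (S : State N n) :
    IsOrbit P (fun j => localPair s (f j)) (searchMap c) ε (fun k => (run s f P c ε S k).x)
      (fun k i => ((run s f P c ε S k).y i, (run s f P c ε S k).z i))
      (fun k i => ((run s f P c ε S k).v i, (run s f P c ε S k).w i)) := by
  have hrun : ∀ k, run s f P c ε S (k + 1) = step s f P c ε (run s f P c ε S k) := fun k =>
    Function.iterate_succ_apply' _ _ _
  refine ⟨fun k i => ?_, fun k => ?_, fun k i => ?_⟩
  · rw [hrun]; rfl
  · rw [hrun]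
    funext i
    simp only [step, mix_apply, Pi.add_apply, Pi.sub_apply, localPair, Prod.mk_sub_mk,
      Prod.mk_add_mk, Prod.smul_mk, add_sub_assoc]
    simp [Prod.ext_iff, Prod.fst_sum, Prod.snd_sum]
  · rw [hrun]; rfl

end NRC

/-! ### The convergence theorem. -/

theorem mainTheorem3 {N n : ℕ} (G : SimpleGraph (Fin N)) (P : Matrix (Fin N) (Fin N) ℝ)
    (hP : NRC.IsConsensusMatrix G P)
    (f : Fin N → NRC.Vec n → ℝ) (hf : ∀ i, ContDiff ℝ 3 (f i))
    (xstar : NRC.Vec n) (hmin : IsMinOn (NRC.globalCost f) Set.univ xstar)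
    (c : ℝ) (hc : 0 < c)
    (hhess : NRC.GeScalar (NRC.hessian (NRC.globalCost f) xstar) c)
    (s : NRC.Curvature) (hs : s = NRC.Curvature.gradient → c ≤ 1) :
    ∃ (a r εbar : ℝ) (Ψ : NRC.Vec n × NRC.Mat n → NRC.Vec n),
      0 < a ∧ 0 < r ∧ 0 < εbar ∧ ContDiff ℝ 1 Ψ ∧
      (∀ (ξy : NRC.Vec n) (ξz : NRC.Mat n), ‖Ψ (ξy, ξz) - xstar‖ ≤ a * (‖ξy‖ + ‖ξz‖)) ∧
      ∀ ε : ℝ, 0 < ε → ε < εbar → ∀ S : NRC.State N n, S.Near s f xstar r →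
        ∀ i, Tendsto (fun k => (NRC.run s f P c ε S k).x i) atTop (𝓝 (Ψ (S.xiY, S.xiZ))) := by
  have := hP.neZero
  have hgrad : (NRC.mean fun j => gradient (f j) xstar) = 0 := by
    rw [← NRC.gradient_globalCost hf, gradient, IsLocalMin.fderiv_eq_zero, map_zero]
    exact hmin.isLocalMin Filter.univ_mem
  have hmean := NRC.mean_localPair (f := f) s xstar hgrad
  have hh : NRC.GeScalar (NRC.mean fun j => NRC.hFun s (f j) xstar) c := by
    rw [NRC.mean_hFun hf]
    exact NRC.geScalar_hFun hhess s hs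
  obtain ⟨S, CS, c', hCS, hc', hS, hmono⟩ := NRC.exists_preconditioner_coordinates hc hhess s
  obtain ⟨μ, ε₁, hμ, hμ1, hε₁, hcontr⟩ := NRC.exists_euler_contraction S
    (NRC.actL n (NRC.hFun s (NRC.globalCost f) xstar)⁻¹ ∘L
      NRC.actL n (NRC.hessian (NRC.globalCost f) xstar)) hc' hmono
  obtain ⟨a, r, εbar, Ψ, ha, hr, hεbar, hΨ, hΨa, hconv⟩ := NRC.exists_limit_map hP
    (φ := fun j => NRC.localPair s (f j)) (F := NRC.searchMap c) (xs := xstar)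
    (fun j => (NRC.contDiff_localPair s (hf j)).contDiffAt)
    (fun j => NRC.hasFDerivAt_localPair s (hf j) xstar)
    (by rw [hmean]; exact NRC.contDiffAt_searchMap hc hh)
    (by rw [hmean]; exact NRC.hasFDerivAt_searchMap hc hh)
    (by rw [hmean]; exact NRC.searchMap_act hc hh xstar)
    (CF := (c / 2)⁻¹) (by positivity) (NRC.norm_searchMap_le hc) hCS hS hμ hμ1 hε₁
    (by
      intro ε hε hεlt d
      have h := NRC.reduced_derivative hf s xstar hc hh d
      refine le_of_eq_of_le ?_ (hcontr ε hε hεlt d)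
      -- (1 - ε) d + ε (d - h⁻¹H d) = d - ε h⁻¹H d.
      refine congrArg (fun v => ‖S v‖) ((congrArg (fun v => (1 - ε) • d + ε • v) h).trans ?_)
      rw [NRC.mean_hFun hf, ContinuousLinearMap.comp_apply, NRC.actL_apply, NRC.actL_apply]
      module)
  refine ⟨a, r, εbar, Ψ, ha, hr, hεbar, hΨ, fun ξy ξz => ?_, ?_⟩
  · refine (hΨa (ξy, ξz)).trans (mul_le_mul_of_nonneg_left ?_ ha.le)
    -- The product space carries the maximum norm, which the sum of the two norms dominates.
    exact max_le (le_add_of_nonneg_right (norm_nonneg _)) (le_add_of_nonneg_left (norm_nonneg _))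
  · intro ε hε hεlt S₀ hnear i
    have hpair : (NRC.mean fun j => NRC.localPair s (f j) xstar)
        = (NRC.mean fun j => NRC.gFun s (f j) xstar, NRC.mean fun j => NRC.hFun s (f j) xstar) :=
      NRC.mean_prod _ _
    have h := hconv ε hε hεlt _ _ _ (NRC.isOrbit_run s f P c ε S₀) hnear.x
      (fun j => by rw [hpair]; exact max_le (hnear.y j) (hnear.z j))
      (fun j => by rw [hpair]; exact max_le (hnear.v j) (hnear.w j)) i
    have hξ := NRC.mean_prod (fun i => S₀.y i - S₀.v i) (fun i => S₀.z i - S₀.w i)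
    exact hξ ▸ h
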